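/- Let $p,q\ge 0$ be integers, $I_{p,q}=\mathrm{diag}(1,\dots,1,-1,\dots,-1)$ ($p$ entries $1$, $q$ entries $-1$), $\langle x,y\rangle=\bar x^{t}I_{p,q}\,y$ on $V=\mathbb C^{p+q}$, $$\mathrm{SU}(p,q)=\{g\in \mathrm{SL}_{p+q}(\mathbb C): \bar g^{t}I_{p,q}\,g=I_{p,q}\},\qquad \mathfrak{su}(p,q)=\{z\in\mathrm M_{p+q}(\mathbb C): \mathrm{tr}\,z=0,\ \bar z^{t}I_{p,q}+I_{p,q}z=0\},$$ and $\mathcal O_X=\{gXg^{-1}: g\in\mathrm{SU}(p,q)\}$ for $X\in\mathfrak{su}(p,q)$. Call $X$ real if $-X\in\mathcal O_X$, and strongly real if $-X=\tau X\tau^{-1}$ for some $\tau\in\mathrm{SU}(p,q)$ with $\tau^2=1$. A signed Young diagram is a finite collection of nonempty rows of signs $\pm1$, arranged by length, where rows of equal length may be permuted; the signs alternate along each row, except that in a row of length $\equiv 3 \pmod 4$ the last sign repeats the one before it. Let $p_d$ (resp. $q_d$) be the number of rows of length $d$ whose first sign is $+1$ (resp. $-1$). A signed Young diagram is attached to a nonzero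 nilpotent $X\in\mathfrak{su}(p,q)$ as follows. Take $H,Y\in\mathfrak{su}(p,q)$ with $[H,X]=2X$, $[H,Y]=-2Y$, $[X,Y]=H$. For $d\ge1$ let $M(d-1)\subseteq V$ be the sum of all irreducible $\mathrm{Span}_{\mathbb R}\{X,H,Y\}$-submodules of $V$ of real dimension $d$, let $L(d-1)=\ker Y\cap M(d-1)$ and $t_d=\dim_{\mathbb C}L(d-1)$. Choose $\mathbb C$-bases $v^d_1,\dots,v^d_{t_d}$ of the spaces $L(d-1)$ such that - $X^dv^d_j=0$ and $H X^l v^d_j=(2l+1-d)X^lv^d_j$ for $0\le l<d$; - the vectors $X^l v^d_j$ ($d\ge 1$, $1\le j\le t_d$, $0\le l<d$) form a $\mathbb C$-basis of $V$, and $\langle\cdot,\cdot\rangle$ vanishes on all pairs of these vectors except the pairs $(X^lv^d_j,\,X^{d-1-l}v^d_j)$; - $\langle v^d_j,X^{d-1}v^d_j\rangle=\pm1$ for $d$ odd and $\sqrt{-1}\,\langle v^d_j,X^{d-1}v^d_j\rangle=\pm1$ for $d$ even. The attached diagram has exactly $t_d$ rows of length $d$ for each $d\ge1$; $p_d$ is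 the number of $j$ with $\langle v^d_j,X^{d-1}v^d_j\rangle=1$ if $d$ is odd, and with $\sqrt{-1}\,\langle v^d_j,X^{d-1}v^d_j\rangle=1$ if $d$ is even; and $q_d=t_d-p_d$. **Theorem.** Let $X\in\mathfrak{su}(p,q)$ be a nonzero nilpotent element. Then exactly one signed Young diagram is attached in this way to elements of $\mathcal O_X$ (it depends neither on the element of the orbit nor on the choices of $H$, $Y$ and $v^d_j$), and for it the following are equivalent: 1. $X$ is real; 2. $X$ is strongly real; 3. $p_\eta=q_\eta$ for every even $\eta$ that occurs as a row length of the diagram. -/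

import Mathlib

open scoped Matrix

attribute [local instance] LieRing.ofAssociativeRing

/-- The space `ℂ^{p+q}`, with its first `p` and last `q` coordinates separated. -/
abbrev PQVec (p q : ℕ) : Type := Fin p ⊕ Fin q → ℂ

/-- Complex square matrices of size `p + q`. -/
abbrev PQMat (p q : ℕ) : Type := Matrix (Fin p ⊕ Fin q) (Fin p ⊕ Fin q) ℂ

/-- `I_{p,q} = diag(1, …, 1, -1, …, -1)`. -/
abbrev Ipq (p q : ℕ) : PQMat p q :=
  LieAlgebra.Orthogonal.indefiniteDiagonal (Fin p) (Fin q) ℂ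

/-- The Hermitian form `⟨x, y⟩ = x̄ᵗ I_{p,q} y` on `ℂ^{p+q}`. -/
def hermForm {p q : ℕ} (x y : PQVec p q) : ℂ :=
  star x ⬝ᵥ (Ipq p q *ᵥ y)

/-- The group `SU(p,q)`. -/
def SU (p q : ℕ) : Subgroup (Matrix.SpecialLinearGroup (Fin p ⊕ Fin q) ℂ) where
  carrier := {g | (g : PQMat p q)ᴴ * Ipq p q * (g : PQMat p q) = Ipq p q}
  mul_mem' := by
    intro a b ha hb
    simp only [Set.mem_ofPred_eq, Matrix.SpecialLinearGroup.coe_mul,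
      Matrix.conjTranspose_mul] at *
    calc (b : PQMat p q)ᴴ * (a : PQMat p q)ᴴ * Ipq p q * ((a : PQMat p q) * (b : PQMat p q))
        = (b : PQMat p q)ᴴ * ((a : PQMat p q)ᴴ * Ipq p q * (a : PQMat p q)) *
            (b : PQMat p q) := by simp only [mul_assoc]
      _ = Ipq p q := by rw [ha, hb]
  one_mem' := by simp
  inv_mem' := by
    intro a ha
    simp only [Set.mem_ofPred_eq] at *
    have h1 : (a : PQMat p q) * ((a⁻¹ : Matrix.SpecialLinearGroup (Fin p ⊕ Fin q) ℂ) :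
        PQMat p q) = 1 := by
      rw [← Matrix.SpecialLinearGroup.coe_mul, mul_inv_cancel, Matrix.SpecialLinearGroup.coe_one]
    have h2 : ((a⁻¹ : Matrix.SpecialLinearGroup (Fin p ⊕ Fin q) ℂ) : PQMat p q)ᴴ *
        (a : PQMat p q)ᴴ = 1 := by
      rw [← Matrix.conjTranspose_mul, h1, Matrix.conjTranspose_one]
    generalize ((a⁻¹ : Matrix.SpecialLinearGroup (Fin p ⊕ Fin q) ℂ) : PQMat p q) = b at *
    calc bᴴ * Ipq p q * b
        = bᴴ * ((a : PQMat p q)ᴴ * Ipq p q * (a : PQMat p q)) * b := by rw [ha]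
      _ = (bᴴ * (a : PQMat p q)ᴴ) * Ipq p q * ((a : PQMat p q) * b) := by
          simp only [mul_assoc]
      _ = Ipq p q := by rw [h1, h2, one_mul, mul_one]

/-- The real Lie algebra `𝔰𝔲(p,q)`, with the commutator bracket. -/
def su (p q : ℕ) : LieSubalgebra ℝ (PQMat p q) where
  carrier := {z | zᴴ * Ipq p q + Ipq p q * z = 0 ∧ z.trace = 0}
  add_mem' := by
    rintro a b ⟨ha, ha'⟩ ⟨hb, hb'⟩
    refine ⟨?_, by rw [Matrix.trace_add, ha', hb', add_zero]⟩
    calc (a + b)ᴴ * Ipq p q + Ipq p q * (a + b)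
        = (aᴴ * Ipq p q + Ipq p q * a) + (bᴴ * Ipq p q + Ipq p q * b) := by
          rw [Matrix.conjTranspose_add]; noncomm_ring
      _ = 0 := by rw [ha, hb, add_zero]
  zero_mem' := by simp
  smul_mem' := by
    rintro c a ⟨ha, ha'⟩
    refine ⟨?_, by rw [Matrix.trace_smul, ha', smul_zero]⟩
    rw [Matrix.conjTranspose_smul, star_trivial, smul_mul_assoc, mul_smul_comm, ← smul_add, ha,
      smul_zero]
  lie_mem' := by
    rintro a b ⟨ha, _⟩ ⟨hb, _⟩
    refine ⟨?_, by rw [Ring.lie_def, Matrix.trace_sub, Matrix.trace_mul_comm, sub_self]⟩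
    have ha1 : aᴴ * Ipq p q = -(Ipq p q * a) := eq_neg_of_add_eq_zero_left ha
    have hb1 : bᴴ * Ipq p q = -(Ipq p q * b) := eq_neg_of_add_eq_zero_left hb
    rw [Ring.lie_def, Matrix.conjTranspose_sub, Matrix.conjTranspose_mul,
      Matrix.conjTranspose_mul, sub_mul, mul_assoc, mul_assoc, ha1, hb1, mul_neg, mul_neg,
      ← mul_assoc, ← mul_assoc, ha1, hb1]
    noncomm_ring

/-- The adjoint action `Ad(g) X = g X g⁻¹` of `SU(p,q)` on `𝔰𝔲(p,q)`. -/
def Ad {p q : ℕ} (g : SU p q) (X : su p q) : su p q :=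
  ⟨((g : Matrix.SpecialLinearGroup (Fin p ⊕ Fin q) ℂ) : PQMat p q) * (X : PQMat p q) *
    (((g⁻¹ : SU p q) : Matrix.SpecialLinearGroup (Fin p ⊕ Fin q) ℂ) : PQMat p q), by
    have hg : (((g : SU p q) : Matrix.SpecialLinearGroup (Fin p ⊕ Fin q) ℂ) : PQMat p q)ᴴ *
      Ipq p q * (((g : SU p q) : Matrix.SpecialLinearGroup (Fin p ⊕ Fin q) ℂ) : PQMat p q) =
      Ipq p q := g.2
    have h1 : ((g : Matrix.SpecialLinearGroup (Fin p ⊕ Fin q) ℂ) : PQMat p q) *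
        (((g⁻¹ : SU p q) : Matrix.SpecialLinearGroup (Fin p ⊕ Fin q) ℂ) : PQMat p q) = 1 := by
      rw [← Matrix.SpecialLinearGroup.coe_mul, ← Subgroup.coe_mul, mul_inv_cancel,
        Subgroup.coe_one, Matrix.SpecialLinearGroup.coe_one]
    generalize (((g⁻¹ : SU p q) : Matrix.SpecialLinearGroup (Fin p ⊕ Fin q) ℂ) :
      PQMat p q) = b at *
    generalize ((g : Matrix.SpecialLinearGroup (Fin p ⊕ Fin q) ℂ) : PQMat p q) = a at *
    obtain ⟨hX, hX'⟩ := X.2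
    generalize (X : PQMat p q) = x at *
    have h2 : bᴴ * aᴴ = 1 := by
      rw [← Matrix.conjTranspose_mul, h1, Matrix.conjTranspose_one]
    have h3 : b * a = 1 := mul_eq_one_comm.mp h1
    have h4 : bᴴ * Ipq p q = Ipq p q * a := by
      calc bᴴ * Ipq p q = bᴴ * (aᴴ * Ipq p q * a) := by rw [hg]
        _ = (bᴴ * aᴴ) * Ipq p q * a := by simp only [mul_assoc]
        _ = Ipq p q * a := by rw [h2, one_mul]
    have h5 : aᴴ * Ipq p q = Ipq p q * b := by
      calc aᴴ * Ipq p q = aᴴ * Ipq p q * (a * b) := by rw [h1, mul_one]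
        _ = (aᴴ * Ipq p q * a) * b := by simp only [mul_assoc]
        _ = Ipq p q * b := by rw [hg]
    refine ⟨?_, ?_⟩
    · have h6 : Ipq p q * a = bᴴ * Ipq p q := h4.symm
      calc (a * x * b)ᴴ * Ipq p q + Ipq p q * (a * x * b)
          = bᴴ * xᴴ * (aᴴ * Ipq p q) + (Ipq p q * a) * x * b := by
            simp only [Matrix.conjTranspose_mul, mul_assoc]
        _ = bᴴ * (xᴴ * Ipq p q + Ipq p q * x) * b := by rw [h5, h6]; noncomm_ring
        _ = 0 := by rw [hX]; simp
    · rw [Matrix.trace_mul_comm, ← mul_assoc, h3, one_mul, hX']⟩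

/-- The adjoint orbit of `X`. -/
def adjointOrbit {p q : ℕ} (X : su p q) : Set (su p q) :=
  {Z | ∃ g : SU p q, Z = Ad g X}

/-- `X` is (`Ad`-)real: `-X` lies in the adjoint orbit of `X`. -/
def IsAdReal {p q : ℕ} (X : su p q) : Prop :=
  -X ∈ adjointOrbit X

/-- `X` is strongly (`Ad`-)real: `-X = Ad(τ) X` for some `τ` in the group with `τ² = 1`. -/
def IsStronglyAdReal {p q : ℕ} (X : su p q) : Prop :=
  ∃ τ : SU p q, τ ^ 2 = 1 ∧ -X = Ad τ X

/-- A row of signs, as in a signed Young diagram: it is nonempty, and the signs alternate along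
it, except that in a row whose length is `3` modulo `4` the last sign repeats the one before it. -/
def IsSignedRow (r : List ℤˣ) : Prop :=
  r ≠ [] ∧ ∀ (l : ℕ) (h : l + 1 < r.length),
    r[l + 1] = if r.length % 4 = 3 ∧ l + 2 = r.length then r[l] else -r[l]

/-- A signed Young diagram. Diagrams that differ by a permutation of rows of equal length are
identified, and the rows of a diagram are ordered by length, so that a diagram is a finite
multiset of rows. -/
@[ext]
structure SignedYoungDiagram where
  rows : Multiset (List ℤˣ)
  isSignedRow : ∀ r ∈ rows, IsSignedRow r

/-- The number `p_d` of `+1`s in the first column of the block of the rows of length `d`. -/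
def SignedYoungDiagram.plusCount (D : SignedYoungDiagram) (d : ℕ) : ℕ :=
  D.rows.countP fun r => r.length = d ∧ r.head? = some 1

/-- The number `q_d` of `-1`s in the first column of the block of the rows of length `d`. -/
def SignedYoungDiagram.minusCount (D : SignedYoungDiagram) (d : ℕ) : ℕ :=
  D.rows.countP fun r => r.length = d ∧ r.head? = some (-1)

/-- The real subspace `W` of `ℂ^{p+q}` is stable under `X`, `H` and `Y`. -/
def IsStable {p q : ℕ} (X H Y : su p q) (W : Submodule ℝ (PQVec p q)) : Prop :=
  ∀ w ∈ W, (X : PQMat p q) *ᵥ w ∈ W ∧ (H : PQMat p q) *ᵥ w ∈ W ∧ (Y : PQMat p q) *ᵥ w ∈ W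

/-- `W` is an irreducible `Span_ℝ {X, H, Y}`-submodule of `ℂ^{p+q}`. -/
def IsIrredSubmodule {p q : ℕ} (X H Y : su p q) (W : Submodule ℝ (PQVec p q)) : Prop :=
  IsStable X H Y W ∧ W ≠ ⊥ ∧ ∀ U ≤ W, IsStable X H Y U → U = ⊥ ∨ U = W

/-- The isotypical component `M(d - 1)`: the sum of all irreducible submodules of real
dimension `d`. -/
noncomputable def isotypical {p q : ℕ} (X H Y : su p q) (d : ℕ) : Submodule ℝ (PQVec p q) :=
  sSup {W | IsIrredSubmodule X H Y W ∧ Module.finrank ℝ W = d}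

/-- The set underlying `L(d - 1) = ker Y ∩ M(d - 1)`. -/
noncomputable def lowestWeight {p q : ℕ} (X H Y : su p q) (d : ℕ) : Set (PQVec p q) :=
  {v | (Y : PQMat p q) *ᵥ v = 0 ∧ v ∈ isotypical X H Y d}

/-- A system of complex bases `v^d_1, …, v^d_{t_d}` of the spaces `L(d - 1)`, for all `d`, such
that the vectors `X^l v^d_j` form an `H`-eigenbasis of `ℂ^{p+q}` on which the Hermitian form is
in normal form. -/
structure NormalBasis {p q : ℕ} (X H Y : su p q) where
  /-- the multiplicities `t_d` -/
  mult : ℕ → ℕ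
  /-- the vectors `v^d_j` -/
  vec : (d : ℕ) → Fin (mult d) → PQVec p q
  linearIndependent : ∀ d, LinearIndependent ℂ (vec d)
  span_eq : ∀ d, (Submodule.span ℂ (Set.range (vec d)) : Set (PQVec p q)) = lowestWeight X H Y d
  pow_eq_zero : ∀ d j, (X : PQMat p q) ^ d *ᵥ vec d j = 0
  weight : ∀ d j, ∀ l < d, (H : PQMat p q) *ᵥ ((X : PQMat p q) ^ l *ᵥ vec d j) =
    ((2 * l + 1 - d : ℤ) : ℂ) • ((X : PQMat p q) ^ l *ᵥ vec d j)
  chains_linearIndependent : LinearIndependent ℂ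
    (fun i : (Σ d : ℕ, Fin (mult d) × Fin d) =>
      (X : PQMat p q) ^ (i.2.2 : ℕ) *ᵥ vec i.1 i.2.1)
  chains_span : Submodule.span ℂ (Set.range
    (fun i : (Σ d : ℕ, Fin (mult d) × Fin d) =>
      (X : PQMat p q) ^ (i.2.2 : ℕ) *ᵥ vec i.1 i.2.1)) = ⊤
  /-- the form vanishes on all pairs of basis vectors, except the pairs
  `(X^l v^d_j, X^{d-1-l} v^d_j)` -/
  orthogonal : ∀ i k : (Σ d : ℕ, Fin (mult d) × Fin d),
    ¬ ((⟨i.1, i.2.1⟩ : Σ d : ℕ, Fin (mult d)) = ⟨k.1, k.2.1⟩ ∧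
        (i.2.2 : ℕ) + (k.2.2 : ℕ) + 1 = i.1) →
      hermForm ((X : PQMat p q) ^ (i.2.2 : ℕ) *ᵥ vec i.1 i.2.1)
        ((X : PQMat p q) ^ (k.2.2 : ℕ) *ᵥ vec k.1 k.2.1) = 0
  normalized_odd : ∀ d j, Odd d →
    hermForm (vec d j) ((X : PQMat p q) ^ (d - 1) *ᵥ vec d j) = 1 ∨
    hermForm (vec d j) ((X : PQMat p q) ^ (d - 1) *ᵥ vec d j) = -1
  normalized_even : ∀ d j, Even d →
    Complex.I * hermForm (vec d j) ((X : PQMat p q) ^ (d - 1) *ᵥ vec d j) = 1 ∨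
    Complex.I * hermForm (vec d j) ((X : PQMat p q) ^ (d - 1) *ᵥ vec d j) = -1

/-- The number `p_d` read off from a normal basis: the number of `j` with
`⟨v^d_j, X^{d-1} v^d_j⟩ = 1` if `d` is odd, and with `√-1 ⟨v^d_j, X^{d-1} v^d_j⟩ = 1` if `d` is
even. -/
noncomputable def NormalBasis.plusCount {p q : ℕ} {X H Y : su p q} (B : NormalBasis X H Y)
    (d : ℕ) : ℕ :=
  Nat.card {j : Fin (B.mult d) // (if Odd d then 1 else Complex.I) *
    hermForm (B.vec d j) ((X : PQMat p q) ^ (d - 1) *ᵥ B.vec d j) = 1}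

/-- The number `q_d = t_d - p_d` read off from a normal basis (`p_d ≤ t_d` by definition). -/
noncomputable def NormalBasis.minusCount {p q : ℕ} {X H Y : su p q} (B : NormalBasis X H Y)
    (d : ℕ) : ℕ :=
  B.mult d - B.plusCount d

/-- `D` is a signed Young diagram of the element `X`: for some `𝔰𝔩₂`-triple `{X, H, Y}` in
`𝔰𝔲(p,q)` and some normal basis, the first column of the block of rows of length `d` has `p_d`
entries `+1` and `q_d` entries `-1`, for all `d`. -/
def HasSignedYoungDiagram {p q : ℕ} (X : su p q) (D : SignedYoungDiagram) : Prop :=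
  ∃ H Y : su p q, IsSl2Triple H X Y ∧ ∃ B : NormalBasis X H Y,
    ∀ d, D.plusCount d = B.plusCount d ∧ D.minusCount d = B.minusCount d

/-- `D` is a signed Young diagram of the orbit `O`: it is one of some element of `O`. -/
def OrbitHasSignedYoungDiagram {p q : ℕ} (O : Set (su p q)) (D : SignedYoungDiagram) : Prop :=
  ∃ X ∈ O, HasSignedYoungDiagram X D

/-!
The nilpotent `X` is treated as a skew-Hermitian endomorphism of `ℂ^{p+q}` with its indefinite
Hermitian form. Two facts about such endomorphisms carry the proof.

*Existence of chains* (`exists_chainBasis`). If `X ^ d` is the first power of `X` that vanishes,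
polarization gives a `v` with `⟨v, X ^ (d - 1) v⟩ ≠ 0`. Adding multiples of the `X ^ r v` makes all
`⟨v, X ^ m v⟩` with `m < d - 1` vanish, so the chain of `v` spans an `X`-stable nondegenerate
subspace, and its orthogonal complement is treated by induction. In the resulting `ChainBasis` the
other two elements of an `𝔰𝔩₂`-triple are given by explicit formulas (`opH`, `opY`). The lowest
weight vectors in the real isotypical component of dimension `d` are the complex combinations of
the generators of the chains of length `d` (`generators_eq_lowestWeight`): a nonzero stable real
subspace contains such a combination `w`, the real span of the chain of `w` is stable, and the
Casimir element determines its dimension. So chain bases and normal bases are the same thing.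

*Inertia* (`ChainBasis.card_le_card`). On `ker X ^ d` the form `⟨z, X ^ (d - 1) z⟩`, multiplied by
`√-1` for even `d`, is diagonal with entries the signs of the chains of length `d`, all other
vectors of the chain basis being in its radical. By Sylvester's argument, an isometry intertwining
`X` with `X'` preserves the numbers of chains of given length and sign, which gives the uniqueness
of the diagram. An isometry intertwining `X` with `-X` exchanges the two signs when `d` is even,
so `p_d = q_d` if `X` is real.

Conversely, if `p_d = q_d` for all even `d`, pair each positive chain of even length with a negative
one of the same length. The map `X ^ l v ↦ ± (-1) ^ l X ^ l v'`, with `v'` the partner of `v`, or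
`v` itself for odd length, is an isometric involution carrying `X` to `-X`. It has determinant `1`
because it is a product `E (R E R)` with involutions `E` and `R`, where `E` acts on the first halves
of the chains only and `R` reverses the chains (`ChainBasis.exists_reversing_involution`).
-/

open scoped ComplexConjugate

/-! ### Orthogonal chain bases -/

/-- The scalar `1` (for odd `d`) or `√-1` (for even `d`) which makes `⟨x, X ^ (d - 1) y⟩` a
Hermitian form when `X` is skew-Hermitian. -/
noncomputable def phase (d : ℕ) : ℂ := if Odd d then 1 else Complex.I

lemma phase_ne_zero (d : ℕ) : phase d ≠ 0 := by
  unfold phase; split_ifs <;> simp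

section Chains

variable {V : Type*} [AddCommGroup V] [Module ℂ V]
  {B : V →ₗ⋆[ℂ] V →ₗ[ℂ] ℂ} {X : Module.End ℂ V} {U : Submodule ℂ V} {ι : Type*}

/-- A decomposition of `U` into Jordan chains `v, X v, …, X ^ (d - 1) v` of an endomorphism `X` such
that the form `B` pairs nontrivially only `X ^ l v` with `X ^ (d - 1 - l) v` in the same chain.
The chains are indexed by `ι`; `sign i` is the normalized value of the form on the ends of the
`i`-th chain. -/
structure ChainBasis (B : V →ₗ⋆[ℂ] V →ₗ[ℂ] ℂ) (X : Module.End ℂ V) (U : Submodule ℂ V)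
    (ι : Type*) where
  /-- the length of a chain -/
  len : ι → ℕ
  /-- the generator of a chain -/
  vec : ι → V
  /-- the sign of a chain -/
  sign : ι → ℤˣ
  len_pos : ∀ i, 0 < len i
  pow_len : ∀ i, (X ^ len i) (vec i) = 0
  orth : ∀ i k l m, ¬ (i = k ∧ l + m + 1 = len i) → B ((X ^ l) (vec i)) ((X ^ m) (vec k)) = 0
  norm : ∀ i, phase (len i) * B (vec i) ((X ^ (len i - 1)) (vec i)) = ((sign i : ℤ) : ℂ)
  span_eq : Submodule.span ℂ
    (Set.range fun a : (Σ i, Fin (len i)) => (X ^ (a.2 : ℕ)) (vec a.1)) = U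

lemma skew_pow (hX : ∀ x y, B (X x) y = -B x (X y)) (l : ℕ) (x y : V) :
    B ((X ^ l) x) y = (-1) ^ l * B x ((X ^ l) y) := by
  induction l generalizing y with
  | zero => simp
  | succ n ih =>
    rw [pow_succ', Module.End.mul_apply, hX, ih, ← Module.End.mul_apply, ← pow_succ, pow_succ' X,
      pow_succ]
    ring

lemma pow_apply_pow (l m : ℕ) (x : V) : (X ^ l) ((X ^ m) x) = (X ^ (l + m)) x := by
  rw [pow_add, Module.End.mul_apply]

namespace ChainBasis

lemma pow_eq_zero (F : ChainBasis B X U ι) (i : ι) {l : ℕ} (h : F.len i ≤ l) :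
    (X ^ l) (F.vec i) = 0 := by
  obtain ⟨k, rfl⟩ := Nat.exists_eq_add_of_le' h
  rw [← pow_apply_pow, F.pow_len, map_zero]

lemma sign_ne_zero (F : ChainBasis B X U ι) (i : ι) : ((F.sign i : ℤ) : ℂ) ≠ 0 := by
  exact_mod_cast (F.sign i).ne_zero

lemma phase_mul_pairing (F : ChainBasis B X U ι) (hX : ∀ x y, B (X x) y = -B x (X y)) (i : ι)
    {l m : ℕ} (h : l + m + 1 = F.len i) :
    phase (F.len i) * B ((X ^ l) (F.vec i)) ((X ^ m) (F.vec i)) =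
      (-1) ^ l * ((F.sign i : ℤ) : ℂ) := by
  have h' : l + m = F.len i - 1 := by omega
  rw [skew_pow hX, pow_apply_pow, h', ← F.norm]
  ring

lemma pairing_ne_zero (F : ChainBasis B X U ι) (hX : ∀ x y, B (X x) y = -B x (X y)) (i : ι)
    {l m : ℕ} (h : l + m + 1 = F.len i) :
    B ((X ^ l) (F.vec i)) ((X ^ m) (F.vec i)) ≠ 0 := by
  intro h0
  have := F.phase_mul_pairing hX i h
  rw [h0, mul_zero] at this
  exact mul_ne_zero (pow_ne_zero _ (by norm_num)) (F.sign_ne_zero i) this.symm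

lemma linearIndependent (F : ChainBasis B X U ι) (hX : ∀ x y, B (X x) y = -B x (X y)) :
    LinearIndependent ℂ fun a : (Σ i, Fin (F.len i)) => (X ^ (a.2 : ℕ)) (F.vec a.1) := by
  rw [linearIndependent_iff']
  rintro s g hg ⟨i, l⟩ hi
  -- the coefficient of `X ^ l v` is read off by pairing with `X ^ (len - 1 - l) v`
  have hl : F.len i - 1 - l + l + 1 = F.len i := by omega
  have h := congrArg (B ((X ^ (F.len i - 1 - l)) (F.vec i))) hg
  rw [map_sum, map_zero, Finset.sum_eq_single ⟨i, l⟩] at h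
  · rw [map_smul, smul_eq_mul] at h
    exact (mul_eq_zero.mp h).resolve_right (F.pairing_ne_zero hX i hl)
  · rintro ⟨k, m⟩ - hne
    rw [map_smul, F.orth, smul_zero]
    rintro ⟨rfl, h2⟩
    dsimp only at h2 hl
    exact hne (congrArg _ (Fin.ext (by omega)))
  · exact fun h' => absurd hi h'

/-- The basis formed by all vectors of the chains. -/
noncomputable def basis (F : ChainBasis B X ⊤ ι) (hX : ∀ x y, B (X x) y = -B x (X y)) :
    Module.Basis (Σ i, Fin (F.len i)) ℂ V :=
  Module.Basis.mk (F.linearIndependent hX) F.span_eq.ge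

@[simp] lemma basis_apply (F : ChainBasis B X ⊤ ι) (hX : ∀ x y, B (X x) y = -B x (X y))
    (a : Σ i, Fin (F.len i)) : F.basis hX a = (X ^ (a.2 : ℕ)) (F.vec a.1) := by
  simp [basis]

/-- The linear map with prescribed values `f i l` on the vectors `X ^ l v` of the chains. -/
noncomputable def lift {W : Type*} [AddCommGroup W] [Module ℂ W]
    (F : ChainBasis B X ⊤ ι) (hX : ∀ x y, B (X x) y = -B x (X y))
    (f : ι → ℕ → W) : V →ₗ[ℂ] W :=
  (F.basis hX).constr ℂ fun a => f a.1 a.2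

lemma lift_apply {W : Type*} [AddCommGroup W] [Module ℂ W]
    (F : ChainBasis B X ⊤ ι) (hX : ∀ x y, B (X x) y = -B x (X y))
    (f : ι → ℕ → W) {i : ι} {l : ℕ} (h : l < F.len i) :
    F.lift hX f ((X ^ l) (F.vec i)) = f i l := by
  have := (F.basis hX).constr_basis ℂ (fun a => f a.1 a.2) ⟨i, l, h⟩
  rwa [basis_apply] at this

lemma hom_ext {W : Type*} [AddCommGroup W] [Module ℂ W]
    (F : ChainBasis B X ⊤ ι) {f g : V →ₗ[ℂ] W}
    (h : ∀ i, ∀ l < F.len i, f ((X ^ l) (F.vec i)) = g ((X ^ l) (F.vec i))) : f = g := by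
  refine LinearMap.ext_on_range F.span_eq ?_
  rintro ⟨i, l⟩
  exact h i l l.2

lemma form_ext (F : ChainBasis B X ⊤ ι) {C D : V →ₗ⋆[ℂ] V →ₗ[ℂ] ℂ}
    (h : ∀ i k l m, l < F.len i → m < F.len k →
      C ((X ^ l) (F.vec i)) ((X ^ m) (F.vec k)) = D ((X ^ l) (F.vec i)) ((X ^ m) (F.vec k))) :
    C = D := by
  refine LinearMap.ext_on_range F.span_eq ?_
  rintro ⟨i, l⟩
  exact F.hom_ext fun k m hm => h i k l m l.2 hm

/-- The coefficient of `X ^ l v` in the expansion of `z` along the `i`-th chain with generator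
`v`; it is `0` when `l` is at least the length of the chain. -/
noncomputable def coeff (F : ChainBasis B X ⊤ ι) (hX : ∀ x y, B (X x) y = -B x (X y))
    (i : ι) (l : ℕ) : V →ₗ[ℂ] ℂ :=
  if h : l < F.len i then (F.basis hX).coord ⟨i, l, h⟩ else 0

lemma coeff_apply (F : ChainBasis B X ⊤ ι) (hX : ∀ x y, B (X x) y = -B x (X y))
    {i : ι} {l : ℕ} (h : l < F.len i) (z : V) :
    F.coeff hX i l z = (F.basis hX).repr z ⟨i, l, h⟩ := by
  simp [coeff, h]

lemma sum_coeff [Fintype ι] (F : ChainBasis B X ⊤ ι) (hX : ∀ x y, B (X x) y = -B x (X y))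
    (z : V) :
    ∑ i, ∑ l ∈ Finset.range (F.len i), F.coeff hX i l z • (X ^ l) (F.vec i) = z := by
  conv_rhs => rw [← (F.basis hX).sum_repr z]
  rw [Fintype.sum_sigma]
  refine Finset.sum_congr rfl fun i _ => ?_
  rw [Finset.sum_range]
  refine Finset.sum_congr rfl fun l _ => ?_
  rw [F.coeff_apply hX l.2, basis_apply]

lemma coeff_pow_vec (F : ChainBasis B X ⊤ ι) (hX : ∀ x y, B (X x) y = -B x (X y))
    [DecidableEq ι] {i k : ι} {l m : ℕ} (hm : m < F.len k) :
    F.coeff hX i l ((X ^ m) (F.vec k)) = if k = i ∧ m = l then 1 else 0 := by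
  by_cases h : l < F.len i
  · rw [F.coeff_apply hX h]
    have := F.basis_apply hX ⟨k, m, hm⟩
    simp only at this
    rw [← this, Module.Basis.repr_self, Finsupp.single_apply]
    congr 1
    rw [eq_iff_iff]
    constructor
    · intro h'
      obtain ⟨rfl, h2⟩ := Sigma.mk.inj_iff.mp h'
      exact ⟨rfl, congrArg Fin.val (eq_of_heq h2)⟩
    · rintro ⟨rfl, rfl⟩
      rfl
  · simp only [coeff, h, dite_false, LinearMap.zero_apply]
    rw [if_neg]
    rintro ⟨rfl, rfl⟩
    exact h hm

lemma pairing_eq_coeff [Fintype ι] (F : ChainBasis B X ⊤ ι)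
    (hX : ∀ x y, B (X x) y = -B x (X y)) (i : ι) {l m : ℕ} (h : l + m + 1 = F.len i) (z : V) :
    B ((X ^ l) (F.vec i)) z =
      F.coeff hX i m z * B ((X ^ l) (F.vec i)) ((X ^ m) (F.vec i)) := by
  classical
  conv_lhs => rw [← F.sum_coeff hX z]
  simp only [map_sum, map_smul, smul_eq_mul]
  rw [Finset.sum_eq_single i, Finset.sum_eq_single m]
  · intro k _ hk
    rw [F.orth, mul_zero]
    rintro ⟨-, h2⟩
    omega
  · intro h'
    exact absurd (Finset.mem_range.mpr (by omega)) h'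
  · intro k _ hk
    refine Finset.sum_eq_zero fun l' _ => ?_
    rw [F.orth, mul_zero]
    rintro ⟨rfl, -⟩
    exact hk rfl
  · simp

end ChainBasis
end Chains

/-! ### Inertia -/

section Inertia

variable {V : Type*} [AddCommGroup V] [Module ℂ V]
  {B : V →ₗ⋆[ℂ] V →ₗ[ℂ] ℂ} {X : Module.End ℂ V} {ι : Type*}

namespace ChainBasis

lemma coeff_eq_zero_of_pow [Fintype ι] (F : ChainBasis B X ⊤ ι)
    (hX : ∀ x y, B (X x) y = -B x (X y)) {d : ℕ} {z : V} (hz : (X ^ d) z = 0) {i : ι} {l : ℕ}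
    (h : l + d < F.len i) : F.coeff hX i l z = 0 := by
  have hm : d + (F.len i - 1 - l - d) + l + 1 = F.len i := by omega
  have h1 := F.pairing_eq_coeff hX i hm z
  rw [← pow_apply_pow d, skew_pow hX, hz, map_zero, mul_zero, pow_apply_pow] at h1
  exact (mul_eq_zero.mp h1.symm).resolve_right (F.pairing_ne_zero hX i hm)

/-- On `ker X ^ d` the Hermitian form `phase d * ⟨z, X ^ (d - 1) z⟩` is diagonal: only the
generators of the chains of length `d` contribute, each with its sign. -/
lemma form_on_ker_pow [Fintype ι] (F : ChainBasis B X ⊤ ι)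
    (hX : ∀ x y, B (X x) y = -B x (X y)) {d : ℕ} (hd : 0 < d) {z : V} (hz : (X ^ d) z = 0) :
    phase d * B z ((X ^ (d - 1)) z) =
      ((∑ i with F.len i = d, (F.sign i : ℤ) * Complex.normSq (F.coeff hX i 0 z) : ℝ) : ℂ) := by
  conv_lhs => enter [2, 1]; rw [← F.sum_coeff hX z]
  simp only [map_sum, LinearMap.sum_apply, LinearMap.map_smulₛₗ, LinearMap.smul_apply, smul_eq_mul,
    Finset.mul_sum, Complex.ofReal_sum, Finset.sum_filter]
  refine Finset.sum_congr rfl fun i _ => ?_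
  -- a chain contributes only through its generator, and only if its length is `d`
  have key : ∀ l ∈ Finset.range (F.len i), ¬ (l = 0 ∧ F.len i = d) →
      phase d * (conj (F.coeff hX i l z) * B ((X ^ l) (F.vec i)) ((X ^ (d - 1)) z)) = 0 := by
    intro l hl hne
    rw [Finset.mem_range] at hl
    by_cases h1 : l + d < F.len i
    · rw [F.coeff_eq_zero_of_pow hX hz h1]; simp
    · have h2 := skew_pow hX (d - 1) ((X ^ l) (F.vec i)) z
      rw [pow_apply_pow] at h2
      have h3 : B ((X ^ (d - 1 + l)) (F.vec i)) z = 0 := by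
        by_cases h4 : F.len i ≤ d - 1 + l
        · rw [F.pow_eq_zero i h4]; simp
        · have h5 : d - 1 + l + 0 + 1 = F.len i := by omega
          rw [F.pairing_eq_coeff hX i (m := 0) (by omega), F.coeff_eq_zero_of_pow hX hz, zero_mul]
          omega
      rw [h3] at h2
      rw [(mul_eq_zero.mp h2.symm).resolve_left (pow_ne_zero _ (by norm_num))]
      simp
  split_ifs with h
  · rw [Finset.sum_eq_single_of_mem 0 (Finset.mem_range.mpr (F.len_pos i))]
    · have h1 := F.pairing_eq_coeff hX i (l := d - 1) (m := 0) (by omega) z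
      have h2 := skew_pow hX (d - 1) (F.vec i) z
      have h3 := F.phase_mul_pairing hX i (l := d - 1) (m := 0) (by omega)
      rw [h1] at h2
      rw [h] at h3
      have h4 : ((-1 : ℂ) ^ (d - 1)) * (-1) ^ (d - 1) = 1 := by
        rw [← mul_pow]; norm_num
      have h5 : B (F.vec i) ((X ^ (d - 1)) z) = (-1) ^ (d - 1) *
          (F.coeff hX i 0 z * B ((X ^ (d - 1)) (F.vec i)) ((X ^ 0) (F.vec i))) := by
        rw [h2, ← mul_assoc, h4, one_mul]
      rw [pow_zero, Module.End.one_apply, h5]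
      push_cast
      rw [← Complex.mul_conj]
      linear_combination (conj (F.coeff hX i 0 z) * (-1) ^ (d - 1) * F.coeff hX i 0 z) * h3 +
        (conj (F.coeff hX i 0 z) * F.coeff hX i 0 z * (F.sign i : ℤ)) * h4
    · intro l hl hne
      exact key l hl fun h' => hne h'.1
  · rw [Finset.sum_eq_zero fun l hl => key l hl fun h' => h h'.2]
    simp

/-- Inertia: an isometry that intertwines `X` with `±X'` cannot decrease the number of chains of
length `d` and of given sign, because it maps a subspace of `ker X ^ d` on which the form of
`form_on_ker_pow` is definite to such a subspace of `ker X' ^ d`. -/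
lemma card_le_card [Fintype ι] (F : ChainBasis B X ⊤ ι) (hX : ∀ x y, B (X x) y = -B x (X y))
    {V' : Type*} [AddCommGroup V'] [Module ℂ V']
    {B' : V' →ₗ⋆[ℂ] V' →ₗ[ℂ] ℂ} {X' : Module.End ℂ V'} {ι' : Type*} [Fintype ι']
    (F' : ChainBasis B' X' ⊤ ι') (hX' : ∀ x y, B' (X' x) y = -B' x (X' y))
    (g : V →ₗ[ℂ] V') (hg : ∀ x y, B' (g x) (g y) = B x y) (s : ℤˣ)
    (hgX : ∀ x, X' (g x) = ((s : ℤ) : ℂ) • g (X x)) {d : ℕ} (hd : 0 < d) (ε : ℤˣ) :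
    Nat.card {i // F.len i = d ∧ F.sign i = ε} ≤
      Nat.card {i // F'.len i = d ∧ F'.sign i = s ^ (d - 1) * ε} := by
  classical
  have hgX' : ∀ (n : ℕ) x, (X' ^ n) (g x) = ((s : ℤ) : ℂ) ^ n • g ((X ^ n) x) := by
    intro n
    induction n with
    | zero => simp
    | succ n ih =>
      intro x
      rw [pow_succ', Module.End.mul_apply, ih, map_smul, hgX, smul_smul, pow_succ' X,
        Module.End.mul_apply, ← pow_succ]
  have hs : ∀ u : ℤˣ, ((u : ℤ) : ℝ) * (u : ℤ) = 1 := fun u => by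
    exact_mod_cast Int.units_coe_mul_self u
  set A := {i // F.len i = d ∧ F.sign i = ε}
  set A' := {i // F'.len i = d ∧ F'.sign i = s ^ (d - 1) * ε}
  let e : (A → ℂ) →ₗ[ℂ] V := Fintype.linearCombination ℂ fun i : A => F.vec i
  let φ : (A → ℂ) →ₗ[ℂ] (A' → ℂ) := LinearMap.pi fun i : A' => F'.coeff hX' i 0 ∘ₗ g ∘ₗ e
  have hφ : Function.Injective φ := by
    rw [← LinearMap.ker_eq_bot, LinearMap.ker_eq_bot']
    intro a ha
    have hz : (X ^ d) (e a) = 0 := by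
      simp only [e, Fintype.linearCombination_apply, map_sum, map_smul]
      exact Finset.sum_eq_zero fun i _ => by rw [F.pow_eq_zero _ i.2.1.le, smul_zero]
    have hz' : (X' ^ d) (g (e a)) = 0 := by rw [hgX', hz, map_zero, smul_zero]
    have hc : ∀ i : A, F.coeff hX i 0 (e a) = a i := by
      intro i
      simp only [e, Fintype.linearCombination_apply, map_sum, map_smul]
      rw [Finset.sum_eq_single i]
      · have := F.coeff_pow_vec hX (i := (i : ι)) (l := 0) (F.len_pos i)
        rw [pow_zero, Module.End.one_apply] at this
        simp [this]
      · intro k _ hk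
        have := F.coeff_pow_vec hX (i := (i : ι)) (l := 0) (F.len_pos k)
        rw [pow_zero, Module.End.one_apply] at this
        rw [this, if_neg (fun h => hk (Subtype.ext h.1)), smul_zero]
      · simp
    have hc0 : ∀ i, F.len i = d → F.sign i ≠ ε → F.coeff hX i 0 (e a) = 0 := by
      intro i _ hi
      simp only [e, Fintype.linearCombination_apply, map_sum, map_smul]
      refine Finset.sum_eq_zero fun k _ => ?_
      have := F.coeff_pow_vec hX (i := i) (l := 0) (F.len_pos k)
      rw [pow_zero, Module.End.one_apply] at this
      rw [this, if_neg, smul_zero]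
      rintro ⟨rfl, -⟩
      exact hi k.2.2
    have hc' : ∀ i : A', F'.coeff hX' i 0 (g (e a)) = 0 := fun i => congrFun ha i
    have h1 := F.form_on_ker_pow hX hd hz
    have h2 := F'.form_on_ker_pow hX' hd hz'
    rw [hgX', map_smul, hg, smul_eq_mul, mul_left_comm, h1] at h2
    have h3 : ((s : ℤ) : ℝ) ^ (d - 1) *
          ∑ i with F.len i = d, (F.sign i : ℤ) * Complex.normSq (F.coeff hX i 0 (e a)) =
        ∑ i with F'.len i = d, (F'.sign i : ℤ) * Complex.normSq (F'.coeff hX' i 0 (g (e a))) := by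
      exact_mod_cast h2
    set u : ℤˣ := s ^ (d - 1) * ε with hu
    have hsu : ((s : ℤ) : ℝ) ^ (d - 1) = (u : ℤ) * (ε : ℤ) := by
      rw [hu]; push_cast; rw [mul_assoc, hs, mul_one]
    -- the two sides have opposite signs after multiplication by the common sign
    have h4 : ∑ i with F.len i = d, (F.sign i : ℤ) * Complex.normSq (F.coeff hX i 0 (e a)) =
        (ε : ℤ) * ∑ i with F.len i = d, Complex.normSq (F.coeff hX i 0 (e a)) := by
      rw [Finset.mul_sum]
      refine Finset.sum_congr rfl fun i hi => ?_
      by_cases h : F.sign i = ε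
      · rw [h]
      · rw [hc0 i (Finset.mem_filter.mp hi).2 h]; simp
    have h5 : ∑ i with F'.len i = d,
          (F'.sign i : ℤ) * Complex.normSq (F'.coeff hX' i 0 (g (e a))) =
        -(u : ℤ) * ∑ i with F'.len i = d, Complex.normSq (F'.coeff hX' i 0 (g (e a))) := by
      rw [Finset.mul_sum]
      refine Finset.sum_congr rfl fun i hi => ?_
      by_cases h : F'.sign i = u
      · rw [hc' ⟨i, (Finset.mem_filter.mp hi).2, h⟩]; simp
      · rw [Int.units_ne_iff_eq_neg.mp h]; push_cast; ring
    rw [h4, h5, hsu] at h3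
    have h6 : ∑ i with F.len i = d, Complex.normSq (F.coeff hX i 0 (e a)) =
        -∑ i with F'.len i = d, Complex.normSq (F'.coeff hX' i 0 (g (e a))) := by
      have := congrArg (fun x : ℝ => ((u : ℤ) : ℝ) * x) h3
      linear_combination this - (∑ i with F.len i = d, Complex.normSq (F.coeff hX i 0 (e a))) *
        (hs u * ((ε : ℤ) * (ε : ℤ)) + hs ε) -
        (∑ i with F'.len i = d, Complex.normSq (F'.coeff hX' i 0 (g (e a)))) * hs u
    have h7 : ∀ i, F.len i = d → Complex.normSq (F.coeff hX i 0 (e a)) = 0 := by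
      have h8 : ∑ i with F.len i = d, Complex.normSq (F.coeff hX i 0 (e a)) = 0 :=
        le_antisymm (h6.le.trans (neg_nonpos.mpr
          (Finset.sum_nonneg fun _ _ => Complex.normSq_nonneg _)))
          (Finset.sum_nonneg fun _ _ => Complex.normSq_nonneg _)
      intro i hi
      exact (Finset.sum_eq_zero_iff_of_nonneg fun _ _ => Complex.normSq_nonneg _).mp h8 i
        (by simp [hi])
    ext i
    rw [← hc i, Complex.normSq_eq_zero.mp (h7 i i.2.1)]
    rfl
  have h := LinearMap.finrank_le_finrank_of_injective hφ
  rwa [Module.finrank_fintype_fun_eq_card, Module.finrank_fintype_fun_eq_card,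
    ← Nat.card_eq_fintype_card, ← Nat.card_eq_fintype_card] at h

end ChainBasis
end Inertia

/-! ### Existence of chain bases -/

section Existence

variable {V : Type*} [AddCommGroup V] [Module ℂ V]
  {B : V →ₗ⋆[ℂ] V →ₗ[ℂ] ℂ} {X : Module.End ℂ V}

lemma conj_form_pow (hB : ∀ x y, conj (B x y) = B y x) (hX : ∀ x y, B (X x) y = -B x (X y))
    (l : ℕ) (x y : V) : conj (B x ((X ^ l) y)) = (-1) ^ l * B y ((X ^ l) x) := by
  rw [hB, skew_pow hX]

/-- A form `⟨x, X ^ n y⟩` which does not vanish identically is nonzero on some diagonal pair. -/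
lemma exists_form_pow_self_ne_zero (U : Submodule ℂ V) {n : ℕ} {x y : V} (hx : x ∈ U)
    (hy : y ∈ U) (hxy : B x ((X ^ n) y) ≠ 0) : ∃ v ∈ U, B v ((X ^ n) v) ≠ 0 := by
  by_contra! h
  have h1 := h _ (U.add_mem hx hy)
  have h2 := h _ (U.add_mem hx (U.smul_mem Complex.I hy))
  simp only [map_add, LinearMap.add_apply, map_smul, LinearMap.map_smulₛₗ, LinearMap.smul_apply,
    smul_eq_mul, h x hx, h y hy, Complex.conj_I] at h1 h2
  have h3 : Complex.I * (B x ((X ^ n) y) - B y ((X ^ n) x)) = 0 := by linear_combination h2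
  have h4 := (mul_eq_zero.mp h3).resolve_left Complex.I_ne_zero
  apply hxy
  linear_combination (h1 + h4) / 2

/-- A generator `v` of a chain of length `n + 1` can be changed into one with
`⟨v, X ^ m v⟩ = 0` for all `m < n`. -/
lemma exists_orthogonal_generator (hB : ∀ x y, conj (B x y) = B y x)
    (hX : ∀ x y, B (X x) y = -B x (X y)) (U : Submodule ℂ V) (hXU : ∀ u ∈ U, X u ∈ U) {n : ℕ}
    (hn : ∀ u ∈ U, (X ^ (n + 1)) u = 0) {v : V} (hv : v ∈ U) (hvn : B v ((X ^ n) v) ≠ 0) :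
    ∃ w ∈ U, B w ((X ^ n) w) ≠ 0 ∧ ∀ m < n, B w ((X ^ m) w) = 0 := by
  have hXU' : ∀ (k : ℕ), ∀ u ∈ U, (X ^ k) u ∈ U := by
    intro k u hu
    induction k with
    | zero => simpa
    | succ k ih => rw [pow_succ', Module.End.mul_apply]; exact hXU _ ih
  have hn' : ∀ k, n < k → ∀ u ∈ U, (X ^ k) u = 0 := by
    intro k hk u hu
    obtain ⟨j, rfl⟩ := Nat.exists_eq_add_of_le' (Nat.succ_le_of_lt hk)
    rw [← pow_apply_pow, hn u hu, map_zero]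
  have hsq : ∀ r : ℕ, ((-1 : ℂ) ^ r) * (-1) ^ r = 1 := fun r => by rw [← mul_pow]; norm_num
  suffices H : ∀ r ≤ n, ∃ w ∈ U, B w ((X ^ n) w) ≠ 0 ∧ ∀ m < n, n ≤ m + r →
      B w ((X ^ m) w) = 0 by
    obtain ⟨w, hw, h1, h2⟩ := H n le_rfl
    exact ⟨w, hw, h1, fun m hm => h2 m hm (by omega)⟩
  intro r
  induction r with
  | zero => exact fun _ => ⟨v, hv, hvn, fun m hm h => by omega⟩
  | succ r ih =>
    intro hr
    obtain ⟨w, hw, h1, h2⟩ := ih (by omega)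
    obtain ⟨k, rfl⟩ := Nat.exists_eq_add_of_le hr
    set c := B w ((X ^ k) w) / B w ((X ^ (r + 1 + k)) w) with hc
    -- adding `a • X ^ (r + 1) w` changes `⟨w, X ^ k w⟩` by `(a ± conj a) * ⟨w, X ^ n w⟩`
    set a := -c / 2 with ha
    have hexp : ∀ m, B (w + a • (X ^ (r + 1)) w) ((X ^ m) (w + a • (X ^ (r + 1)) w)) =
        B w ((X ^ m) w) + (a + conj a * (-1) ^ (r + 1)) * B w ((X ^ (r + 1 + m)) w) +
        conj a * a * (-1) ^ (r + 1) * B w ((X ^ (r + 1 + (m + (r + 1)))) w) := by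
      intro m
      simp only [map_add, LinearMap.add_apply, map_smul, LinearMap.map_smulₛₗ,
        LinearMap.smul_apply, smul_eq_mul, skew_pow hX, pow_apply_pow, add_comm m (r + 1)]
      ring
    have hcc : conj c = (-1) ^ (r + 1) * c := by
      rw [hc, map_div₀, conj_form_pow hB hX, conj_form_pow hB hX, pow_add (-1 : ℂ) (r + 1) k]
      have := hsq (r + 1)
      have h0 : ((-1 : ℂ)) ^ k ≠ 0 := pow_ne_zero _ (by norm_num)
      have h0' : ((-1 : ℂ)) ^ (r + 1) ≠ 0 := pow_ne_zero _ (by norm_num)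
      field_simp
      linear_combination -B w ((X ^ k) w) * this
    refine ⟨w + a • (X ^ (r + 1)) w, U.add_mem hw (U.smul_mem _ (hXU' _ _ hw)), ?_, ?_⟩
    · rw [hexp, hn' (r + 1 + (r + 1 + k)) (by omega) w hw,
        hn' (r + 1 + (r + 1 + k + (r + 1))) (by omega) w hw]
      simpa using h1
    · intro m hm hmr
      rw [hexp, hn' (r + 1 + (m + (r + 1))) (by omega) w hw, map_zero, mul_zero, add_zero]
      by_cases hmk : m = k
      · subst hmk
        have hcn : c * B w ((X ^ (r + 1 + m)) w) = B w ((X ^ m) w) := by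
          rw [hc]; field_simp
        have hca : conj a = -((-1) ^ (r + 1) * c) / 2 := by
          rw [ha, ← hcc, map_div₀, map_neg, map_ofNat]
        rw [hca]
        linear_combination (-1 : ℂ) * hcn + (-1 / 2 * c * B w ((X ^ (r + 1 + m)) w)) * hsq (r + 1)
      · rw [hn' (r + 1 + m) (by omega) w hw, h2 m hm (by omega)]
        simp

lemma exists_normalized_generator (hB : ∀ x y, conj (B x y) = B y x)
    (hX : ∀ x y, B (X x) y = -B x (X y)) (U : Submodule ℂ V) {n : ℕ}
    {v : V} (hv : v ∈ U) (hvn : B v ((X ^ n) v) ≠ 0) (hv0 : ∀ m < n, B v ((X ^ m) v) = 0) :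
    ∃ w ∈ U, (∃ s : ℤˣ, phase (n + 1) * B w ((X ^ n) w) = ((s : ℤ) : ℂ)) ∧
      ∀ m < n, B w ((X ^ m) w) = 0 := by
  obtain ⟨r, hr⟩ : ∃ r : ℝ, phase (n + 1) * B v ((X ^ n) v) = r := by
    refine (Complex.conj_eq_iff_real.mp ?_).imp fun r h => h
    rw [map_mul, conj_form_pow hB hX, phase]
    split_ifs with h
    · have : Even n := by simpa [Nat.odd_add_one] using h
      simp [this.neg_one_pow]
    · have : Odd n := by simpa [Nat.odd_add_one] using h
      simp [this.neg_one_pow]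
  have hr0 : r ≠ 0 := by
    rintro rfl
    exact mul_ne_zero (phase_ne_zero _) hvn (by simpa using hr)
  have hsm : ∀ (t : ℝ) (m : ℕ), B ((t : ℂ) • v) ((X ^ m) ((t : ℂ) • v)) =
      (t : ℂ) ^ 2 * B v ((X ^ m) v) := by
    intro t m
    simp only [map_smul, LinearMap.map_smulₛₗ, LinearMap.smul_apply, smul_eq_mul,
      Complex.conj_ofReal]
    ring
  refine ⟨(((√|r|)⁻¹ : ℝ) : ℂ) • v, U.smul_mem _ hv, ?_, fun m hm => by
    rw [hsm, hv0 m hm, mul_zero]⟩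
  have h1 : (((√|r|)⁻¹ : ℝ) : ℂ) ^ 2 = ((|r|⁻¹ : ℝ) : ℂ) := by
    rw [← Complex.ofReal_pow, inv_pow, Real.sq_sqrt (abs_nonneg r)]
  have h2 : phase (n + 1) * B ((((√|r|)⁻¹ : ℝ) : ℂ) • v) ((X ^ n) ((((√|r|)⁻¹ : ℝ) : ℂ) • v)) =
      ((|r|⁻¹ * r : ℝ) : ℂ) := by
    rw [hsm, h1, mul_left_comm, hr]
    push_cast
    rfl
  rw [h2]
  rcases lt_or_gt_of_ne hr0 with h | h
  · refine ⟨-1, ?_⟩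
    rw [abs_of_neg h, inv_neg, neg_mul, inv_mul_cancel₀ hr0]
    simp
  · refine ⟨1, ?_⟩
    rw [abs_of_pos h, inv_mul_cancel₀ hr0]
    simp

lemma ChainBasis.pow_vec_mem {ι : Type*} {U : Submodule ℂ V} (F : ChainBasis B X U ι) (i : ι)
    (l : ℕ) : (X ^ l) (F.vec i) ∈ U := by
  by_cases h : l < F.len i
  · exact F.span_eq.le (Submodule.subset_span ⟨⟨i, l, h⟩, rfl⟩)
  · rw [F.pow_eq_zero i (not_lt.mp h)]
    exact U.zero_mem

/-- Orthogonal projection to a chain: modulo the chain of `v`, every vector is orthogonal to it. -/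
lemma exists_sub_chain_orthogonal {n : ℕ} {v : V} (hvn : ∀ k, n < k → (X ^ k) v = 0)
    (hvv : ∀ l m, ¬ l + m = n → B ((X ^ l) v) ((X ^ m) v) = 0)
    (hvn0 : ∀ l m, l + m = n → B ((X ^ l) v) ((X ^ m) v) ≠ 0) (u : V) :
    ∃ c : ℕ → ℂ, ∀ l, B ((X ^ l) v) (u - ∑ m ∈ Finset.range (n + 1), c m • (X ^ m) v) = 0 := by
  refine ⟨fun m => B ((X ^ (n - m)) v) u / B ((X ^ (n - m)) v) ((X ^ m) v), fun l => ?_⟩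
  by_cases hl : n < l
  · rw [hvn l hl]; simp
  · rw [map_sub, map_sum, Finset.sum_eq_single (n - l)]
    · beta_reduce
      rw [map_smul, smul_eq_mul, show n - (n - l) = l by omega,
        div_mul_cancel₀ _ (hvn0 _ _ (by omega)), sub_self]
    · intro m hm hne
      rw [map_smul, hvv l m (by omega), smul_zero]
    · intro h
      exact absurd (Finset.mem_range.mpr (by omega)) h

/-- The pairings within a chain are determined by those with its generator. -/
lemma chain_pairing (hX : ∀ x y, B (X x) y = -B x (X y)) {n : ℕ} {v : V}
    (hvn : (X ^ (n + 1)) v = 0) (hvn0 : B v ((X ^ n) v) ≠ 0)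
    (hv0 : ∀ m < n, B v ((X ^ m) v) = 0) :
    (∀ k, n < k → (X ^ k) v = 0) ∧
    (∀ l m, ¬ l + m = n → B ((X ^ l) v) ((X ^ m) v) = 0) ∧
    (∀ l m, l + m = n → B ((X ^ l) v) ((X ^ m) v) ≠ 0) := by
  have hvn' : ∀ k, n < k → (X ^ k) v = 0 := by
    intro k hk
    obtain ⟨j, rfl⟩ := Nat.exists_eq_add_of_le' (Nat.succ_le_of_lt hk)
    rw [← pow_apply_pow, hvn, map_zero]
  refine ⟨hvn', fun l m h => ?_, fun l m h h0 => ?_⟩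
  · rw [skew_pow hX, pow_apply_pow]
    rcases lt_or_gt_of_ne h with h | h
    · rw [hv0 _ h, mul_zero]
    · rw [hvn' _ h, map_zero, mul_zero]
  · rw [skew_pow hX, pow_apply_pow, h] at h0
    exact hvn0 ((mul_eq_zero.mp h0).resolve_left (pow_ne_zero _ (by norm_num)))

lemma form_ne_zero_of_phase_mul {n : ℕ} {v : V} {s : ℤˣ}
    (hs : phase (n + 1) * B v ((X ^ n) v) = ((s : ℤ) : ℂ)) : B v ((X ^ n) v) ≠ 0 := by
  intro h
  rw [h, mul_zero] at hs
  exact s.ne_zero (by exact_mod_cast hs.symm)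

/-- A chain basis of the orthogonal complement in `U` of a chain of length `n + 1` extends by this
chain to a chain basis of `U`. -/
lemma ChainBasis.exists_option {ι : Type*} {U U' : Submodule ℂ V} (F : ChainBasis B X U' ι)
    (hB : ∀ x y, conj (B x y) = B y x) (hX : ∀ x y, B (X x) y = -B x (X y)) {n : ℕ} {v : V}
    (hv : ∀ m, (X ^ m) v ∈ U) (hvn : (X ^ (n + 1)) v = 0) {s : ℤˣ}
    (hs : phase (n + 1) * B v ((X ^ n) v) = ((s : ℤ) : ℂ)) (hv0 : ∀ m < n, B v ((X ^ m) v) = 0)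
    (hU' : ∀ u, u ∈ U' ↔ u ∈ U ∧ ∀ m, B ((X ^ m) v) u = 0) :
    Nonempty (ChainBasis B X U (Option ι)) := by
  obtain ⟨hvn', hvv, hvn0⟩ := chain_pairing hX hvn (form_ne_zero_of_phase_mul hs) hv0
  refine ⟨{ len := fun i => i.elim (n + 1) F.len
            vec := fun i => i.elim v F.vec
            sign := fun i => i.elim s F.sign
            len_pos := ?_
            pow_len := ?_
            orth := ?_
            norm := ?_
            span_eq := ?_ }⟩
  · rintro (_ | i)
    exacts [Nat.succ_pos n, F.len_pos i]
  · rintro (_ | i)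
    exacts [hvn, F.pow_len i]
  · rintro (_ | i) (_ | k) l m h
    · exact hvv l m fun h' => h ⟨rfl, congrArg (· + 1) h'⟩
    · exact ((hU' _).mp (F.pow_vec_mem k m)).2 l
    · have := ((hU' _).mp (F.pow_vec_mem i l)).2 m
      rw [← hB]
      exact (congrArg conj this).trans (map_zero _)
    · exact F.orth i k l m fun h' => h ⟨congrArg some h'.1, h'.2⟩
  · rintro (_ | i)
    exacts [hs, F.norm i]
  · refine le_antisymm (Submodule.span_le.mpr ?_) fun u hu => ?_
    · rintro _ ⟨⟨_ | i, l⟩, rfl⟩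
      exacts [hv _, ((hU' _).mp (F.pow_vec_mem i l)).1]
    · set S := Submodule.span ℂ (Set.range fun a : (Σ i : Option ι,
        Fin (i.elim (n + 1) F.len : ℕ)) => (X ^ (a.2 : ℕ)) (a.1.elim v F.vec : V)) with hS
      have h1 : ∀ m < n + 1, (X ^ m) v ∈ S := fun m hm =>
        Submodule.subset_span ⟨⟨none, m, hm⟩, rfl⟩
      have h2 : U' ≤ S := by
        rw [← F.span_eq]
        refine Submodule.span_le.mpr ?_
        rintro _ ⟨⟨i, l⟩, rfl⟩
        exact Submodule.subset_span ⟨⟨some i, l⟩, rfl⟩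
      obtain ⟨c, hc⟩ := exists_sub_chain_orthogonal hvn' hvv hvn0 u
      have hwS := S.sum_mem (t := Finset.range (n + 1)) fun m hm =>
        S.smul_mem (c m) (h1 m (Finset.mem_range.mp hm))
      have hwU := U.sum_mem (t := Finset.range (n + 1)) fun m _ => U.smul_mem (c m) (hv m)
      have := S.add_mem (h2 ((hU' _).mpr ⟨U.sub_mem hu hwU, hc⟩)) hwS
      rwa [sub_add_cancel] at this

/-- A nilpotent skew-Hermitian endomorphism of a space with a nondegenerate Hermitian form has a
chain basis. -/
theorem exists_chainBasis [FiniteDimensional ℂ V] (hB : ∀ x y, conj (B x y) = B y x)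
    (hX : ∀ x y, B (X x) y = -B x (X y)) (hnil : IsNilpotent X) (U : Submodule ℂ V)
    (hXU : ∀ u ∈ U, X u ∈ U) (hU : ∀ x ∈ U, (∀ y ∈ U, B x y = 0) → x = 0) :
    ∃ (ι : Type) (_ : Finite ι), Nonempty (ChainBasis B X U ι) := by
  induction hN : Module.finrank ℂ U using Nat.strong_induction_on generalizing U with
  | _ N ih =>
  subst hN
  by_cases hbot : U = ⊥
  · subst hbot
    exact ⟨Empty, inferInstance, ⟨{
      len := Empty.elim, vec := Empty.elim, sign := Empty.elim, len_pos := fun i => i.elim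
      pow_len := fun i => i.elim, orth := fun i => i.elim, norm := fun i => i.elim
      span_eq := by simp [Set.range_eq_empty] }⟩⟩
  have hXU' : ∀ (k : ℕ), ∀ u ∈ U, (X ^ k) u ∈ U := by
    intro k u hu
    induction k with
    | zero => simpa
    | succ k ih => rw [pow_succ', Module.End.mul_apply]; exact hXU _ ih
  have hex : ∃ k, ∀ u ∈ U, (X ^ k) u = 0 := by
    obtain ⟨k, hk⟩ := hnil
    exact ⟨k, fun u _ => by rw [hk]; rfl⟩
  classical
  obtain ⟨n, hn⟩ : ∃ n, Nat.find hex = n + 1 := by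
    refine Nat.exists_eq_succ_of_ne_zero fun h0 => hbot ?_
    have := Nat.find_spec hex
    rw [h0] at this
    exact (Submodule.eq_bot_iff U).mpr this
  have hn1 : ∀ u ∈ U, (X ^ (n + 1)) u = 0 := hn ▸ Nat.find_spec hex
  obtain ⟨y, hy, hy0⟩ : ∃ y ∈ U, (X ^ n) y ≠ 0 := by
    have := Nat.find_min hex (m := n) (by omega)
    push Not at this
    exact this
  obtain ⟨x, hx, hxy⟩ : ∃ x ∈ U, B x ((X ^ n) y) ≠ 0 := by
    by_contra! h
    refine hy0 (hU _ (hXU' _ _ hy) fun x hx => ?_)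
    rw [← hB, h x hx, map_zero]
  obtain ⟨v₀, hv₀, h₀⟩ := exists_form_pow_self_ne_zero U hx hy hxy
  obtain ⟨v₁, hv₁, h₁, h₁'⟩ := exists_orthogonal_generator hB hX U hXU hn1 hv₀ h₀
  obtain ⟨v, hv, ⟨s, hs⟩, hv0⟩ := exists_normalized_generator hB hX U hv₁ h₁ h₁'
  let U' : Submodule ℂ V := U ⊓ ⨅ m, LinearMap.ker (B ((X ^ m) v))
  have hU' : ∀ u, u ∈ U' ↔ u ∈ U ∧ ∀ m, B ((X ^ m) v) u = 0 := by
    intro u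
    simp [U', Submodule.mem_iInf]
  have hvn : B v ((X ^ n) v) ≠ 0 := form_ne_zero_of_phase_mul hs
  have hlt : U' < U := by
    refine lt_of_le_of_ne inf_le_left fun h => hvn ?_
    have := ((hU' ((X ^ n) v)).mp (h ▸ hXU' n v hv)).2 0
    simpa using this
  have hdecomp : ∀ u ∈ U, ∀ x ∈ U', (∀ y ∈ U', B x y = 0) → B x u = 0 := by
    intro u hu x hx h
    obtain ⟨hvn', hvv, hvn0⟩ := chain_pairing hX (hn1 v hv) hvn hv0
    obtain ⟨c, hc⟩ := exists_sub_chain_orthogonal hvn' hvv hvn0 u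
    have h1 := h _ ((hU' _).mpr ⟨U.sub_mem hu
      (U.sum_mem (t := Finset.range (n + 1)) fun m _ => U.smul_mem (c m) (hXU' m v hv)), hc⟩)
    rw [map_sub, map_sum, Finset.sum_eq_zero, sub_zero] at h1
    · exact h1
    · intro m _
      rw [map_smul, ← hB, ((hU' x).mp hx).2 m, map_zero, smul_zero]
  obtain ⟨ι, hι, ⟨F⟩⟩ := ih _ (Submodule.finrank_lt_finrank_of_lt hlt) U' (by
      intro u hu
      obtain ⟨h1, h2⟩ := (hU' u).mp hu
      refine (hU' _).mpr ⟨hXU u h1, fun m => ?_⟩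
      have := h2 (m + 1)
      rw [pow_succ', Module.End.mul_apply, hX] at this
      simpa using this) (fun x hx h => hU x ((hU' x).mp hx).1 fun u hu => hdecomp u hu x hx h) rfl
  obtain ⟨F'⟩ := F.exists_option hB hX (fun m => hXU' m v hv) (hn1 v hv) hs hv0 hU'
  exact ⟨Option ι, inferInstance, ⟨F'⟩⟩

end Existence

/-! ### The reversing involution -/

section Reversal

/-- Balanced signs on the even-length chains give an involution of the set of chains that
preserves lengths, preserves the signs of the chains of odd length and reverses the signs of
those of even length. -/
lemma exists_involution {ι : Type*} [Finite ι] (len : ι → ℕ) (sign : ι → ℤˣ)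
    (h : ∀ d, Even d → Nat.card {i // len i = d ∧ sign i = 1} =
      Nat.card {i // len i = d ∧ sign i = -1}) :
    ∃ σ : ι → ι, (∀ i, σ (σ i) = i) ∧ (∀ i, len (σ i) = len i) ∧
      (∀ i, Odd (len i) → σ i = i) ∧ ∀ i, Even (len i) → sign (σ i) = -sign i := by
  classical
  have he : ∀ d, Even d →
      Nonempty ({i // len i = d ∧ sign i = 1} ≃ {i // len i = d ∧ sign i = -1}) :=
    fun d hd => ⟨(Finite.equivFin _).trans ((finCongr (h d hd)).trans (Finite.equivFin _).symm)⟩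
  have e : ∀ d, Even d → ({i // len i = d ∧ sign i = 1} ≃ {i // len i = d ∧ sign i = -1}) :=
    fun d hd => (he d hd).some
  have hneg : ∀ {i}, sign i ≠ 1 → sign i = -1 := fun h => (Int.units_eq_one_or _).resolve_left h
  let σ : ι → ι := fun i => if hi : Even (len i) then
      if h1 : sign i = 1 then (e (len i) hi ⟨i, rfl, h1⟩).1
      else ((e (len i) hi).symm ⟨i, rfl, hneg h1⟩).1
    else i
  have hp : ∀ d (hd : Even d) (a : {i // len i = d ∧ sign i = 1}), σ a.1 = (e d hd a).1 := by
    rintro _ hd ⟨i, rfl, h1⟩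
    simp only [σ, hd, h1, dite_true]
  have hm : ∀ d (hd : Even d) (a : {i // len i = d ∧ sign i = -1}),
      σ a.1 = ((e d hd).symm a).1 := by
    rintro _ hd ⟨i, rfl, h1⟩
    have h2 : sign i ≠ 1 := by rw [h1]; decide
    simp only [σ, hd, h2, dite_true, dite_false]
  have ho : ∀ i, Odd (len i) → σ i = i := by
    intro i hi
    simp only [σ, Nat.not_even_iff_odd.mpr hi, dite_false]
  -- the four properties hold at every chain, according to the parity of its length and its sign
  have key : ∀ i, σ (σ i) = i ∧ len (σ i) = len i ∧ (Even (len i) → sign (σ i) = -sign i) := by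
    intro i
    rcases Nat.even_or_odd (len i) with hi | hi
    · by_cases h1 : sign i = 1
      · have h2 := hp _ hi ⟨i, rfl, h1⟩
        have h3 := (e _ hi ⟨i, rfl, h1⟩).2
        simp only at h2
        rw [h2, hm _ hi, Equiv.symm_apply_apply]
        exact ⟨rfl, h3.1, fun _ => by rw [h3.2, h1]⟩
      · have h2 := hm _ hi ⟨i, rfl, hneg h1⟩
        have h3 := ((e _ hi).symm ⟨i, rfl, hneg h1⟩).2
        simp only at h2
        rw [h2, hp _ hi, Equiv.apply_symm_apply]
        exact ⟨rfl, h3.1, fun _ => by rw [h3.2, hneg h1, neg_neg]⟩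
    · rw [ho i hi, ho i hi]
      exact ⟨rfl, rfl, fun h' => absurd hi (Nat.not_odd_iff_even.mpr h')⟩
  exact ⟨σ, fun i => (key i).1, fun i => (key i).2.1, ho, fun i => (key i).2.2⟩

variable {V : Type*} [AddCommGroup V] [Module ℂ V]
  {B : V →ₗ⋆[ℂ] V →ₗ[ℂ] ℂ} {X : Module.End ℂ V} {ι : Type*}

lemma det_eq_one_of_conj_involutions {E R : Module.End ℂ V} (hE : E * E = 1) (hR : R * R = 1) :
    LinearMap.det (E * R * E * R) = 1 := by
  have h1 : LinearMap.det E * LinearMap.det E = 1 := by rw [← map_mul, hE, map_one]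
  have h2 : LinearMap.det R * LinearMap.det R = 1 := by rw [← map_mul, hR, map_one]
  simp only [map_mul]
  linear_combination (LinearMap.det R * LinearMap.det R) * h1 + h2

/-- If the signs of the chains of even length are balanced, then `X` is carried to `-X` by an
isometric involution of determinant `1`. -/
theorem ChainBasis.exists_reversing_involution [Finite ι] (F : ChainBasis B X ⊤ ι)
    (hX : ∀ x y, B (X x) y = -B x (X y))
    (h : ∀ d, Even d → Nat.card {i // F.len i = d ∧ F.sign i = 1} =
      Nat.card {i // F.len i = d ∧ F.sign i = -1}) :
    ∃ τ : Module.End ℂ V, τ * τ = 1 ∧ LinearMap.det τ = 1 ∧ τ * X = -(X * τ) ∧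
      ∀ x y, B (τ x) (τ y) = B x y := by
  obtain ⟨σ, hσ, hlen, hodd, heven⟩ := exists_involution F.len F.sign h
  -- the sign `κ i` makes `τ` below fix the middle vector of a chain of odd length
  set κ : ι → ℂ := fun i => (-1) ^ ((F.len i - 1) / 2) with hκ
  have hκσ : ∀ i, κ (σ i) = κ i := fun i => by simp only [hκ, hlen]
  have hsq : ∀ r : ℕ, ((-1 : ℂ) ^ r) * (-1) ^ r = 1 := fun r => by rw [← mul_pow]; norm_num
  have hκκ : ∀ i, κ i * κ i = 1 := fun i => hsq _
  have hss : ∀ i, ((F.sign i : ℤ) : ℂ) * (F.sign i : ℤ) = 1 := fun i => by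
    exact_mod_cast Int.units_coe_mul_self (F.sign i)
  have hsσ : ∀ i, ((F.sign (σ i) : ℤ) : ℂ) = (-1) ^ (F.len i - 1) * (F.sign i : ℤ) := by
    intro i
    have := F.len_pos i
    rcases Nat.even_or_odd (F.len i) with hi | hi
    · have h1 : Odd (F.len i - 1) := by rw [Nat.even_iff] at hi; rw [Nat.odd_iff]; omega
      rw [heven i hi, h1.neg_one_pow]; simp
    · have h1 : Even (F.len i - 1) := by rw [Nat.odd_iff] at hi; rw [Nat.even_iff]; omega
      rw [hodd i hi, h1.neg_one_pow, one_mul]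
  set τ : Module.End ℂ V := F.lift hX fun i l => (κ i * (-1) ^ l) • (X ^ l) (F.vec (σ i)) with hτ
  have hτa : ∀ i l, τ ((X ^ l) (F.vec i)) = (κ i * (-1) ^ l) • (X ^ l) (F.vec (σ i)) := by
    intro i l
    by_cases hl : l < F.len i
    · rw [hτ, F.lift_apply hX _ hl]
    · rw [F.pow_eq_zero i (by omega), F.pow_eq_zero (σ i) (by rw [hlen]; omega)]; simp
  -- `τ` is a product `E * (R * E * R)` of two conjugate involutions: `E` acts as `τ` on the
  -- first halves of the chains, and `R` reverses the chains
  set E : Module.End ℂ V := F.lift hX fun i l => if 2 * l + 1 < F.len i then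
    (κ i * (-1) ^ l) • (X ^ l) (F.vec (σ i)) else (X ^ l) (F.vec i) with hE
  set R : Module.End ℂ V := F.lift hX fun i l =>
    ((F.sign i : ℤ) : ℂ) • (X ^ (F.len i - 1 - l)) (F.vec i) with hR
  have hEa : ∀ i l, l < F.len i → E ((X ^ l) (F.vec i)) = if 2 * l + 1 < F.len i then
      (κ i * (-1) ^ l) • (X ^ l) (F.vec (σ i)) else (X ^ l) (F.vec i) :=
    fun i l hl => F.lift_apply hX _ hl
  have hRa : ∀ i l, l < F.len i → R ((X ^ l) (F.vec i)) =
      ((F.sign i : ℤ) : ℂ) • (X ^ (F.len i - 1 - l)) (F.vec i) :=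
    fun i l hl => F.lift_apply hX _ hl
  have hEE : E * E = 1 := by
    refine F.hom_ext fun i l hl => ?_
    rw [Module.End.mul_apply, Module.End.one_apply, hEa i l hl]
    split_ifs with h1
    · rw [map_smul, hEa _ l (by rw [hlen]; exact hl), hlen, if_pos h1, smul_smul, hσ, hκσ]
      rw [show κ i * (-1) ^ l * (κ i * (-1) ^ l) = 1 by
        linear_combination (κ i * κ i) * hsq l + hκκ i, one_smul]
    · rw [hEa i l hl, if_neg h1]
  have hRR : R * R = 1 := by
    refine F.hom_ext fun i l hl => ?_
    rw [Module.End.mul_apply, Module.End.one_apply, hRa i l hl, map_smul,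
      hRa i _ (by omega), smul_smul, hss, one_smul,
      show F.len i - 1 - (F.len i - 1 - l) = l by omega]
  have hττ : τ = E * R * E * R := by
    refine F.hom_ext fun i l hl => ?_
    rw [hτa]
    simp only [Module.End.mul_apply]
    have h0 : F.len i - 1 - (F.len i - 1 - l) = l := by omega
    rw [hRa i l hl, map_smul, hEa i _ (by omega)]
    by_cases h1 : 2 * (F.len i - 1 - l) + 1 < F.len i
    · have h2 : ¬ 2 * l + 1 < F.len i := by omega
      rw [if_pos h1, map_smul, map_smul, map_smul, hRa (σ i) _ (by rw [hlen]; omega), hlen, h0,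
        map_smul, map_smul, hEa (σ i) l (by rw [hlen]; omega), hlen, if_neg h2, smul_smul,
        smul_smul, hsσ]
      congr 1
      have h3 := neg_one_pow_congr (R := ℂ) (m := F.len i - 1 - l + (F.len i - 1)) (n := l)
        (by rw [Nat.even_iff, Nat.even_iff]; omega)
      rw [pow_add] at h3
      linear_combination (-κ i) * h3 - κ i * (-1) ^ (F.len i - 1 - l) * (-1) ^ (F.len i - 1) * hss i
    · rw [if_neg h1, map_smul, hRa i _ (by omega), h0, smul_smul, hss, one_smul, hEa i l hl]
      split_ifs with h2
      · rfl
      · have h3 : F.len i = 2 * l + 1 := by omega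
        rw [hodd i (by rw [h3]; exact ⟨l, rfl⟩)]
        simp only [hκ, h3]
        rw [show (2 * l + 1 - 1) / 2 = l by omega, hsq, one_smul]
  refine ⟨τ, ?_, hττ ▸ det_eq_one_of_conj_involutions hEE hRR, ?_, ?_⟩
  · refine F.hom_ext fun i l _ => ?_
    rw [Module.End.mul_apply, Module.End.one_apply, hτa, map_smul, hτa, smul_smul, hσ, hκσ,
      show κ i * (-1) ^ l * (κ i * (-1) ^ l) = 1 by
        linear_combination (κ i * κ i) * hsq l + hκκ i, one_smul]
  · refine F.hom_ext fun i l _ => ?_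
    have h1 : ∀ v, X ((X ^ l) v) = (X ^ (l + 1)) v := fun v => by
      rw [pow_succ', Module.End.mul_apply]
    rw [Module.End.mul_apply, LinearMap.neg_apply, Module.End.mul_apply, hτa, map_smul, h1, h1, hτa,
      pow_succ (-1 : ℂ), mul_neg_one, mul_neg, neg_smul]
  · suffices H : ((B.compl₂ τ).comp τ) = B from
      fun x y => DFunLike.congr_fun (DFunLike.congr_fun H x) y
    refine F.form_ext fun i k l m hl hm => ?_
    rw [LinearMap.comp_apply, LinearMap.compl₂_apply, hτa, hτa, map_smul, LinearMap.map_smulₛₗ,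
      LinearMap.smul_apply, smul_eq_mul, smul_eq_mul]
    by_cases hik : i = k ∧ l + m + 1 = F.len i
    · obtain ⟨rfl, hlm⟩ := hik
      have h1 := F.phase_mul_pairing hX i hlm
      have h2 := F.phase_mul_pairing hX (σ i) (l := l) (m := m) (by rw [hlen, hlm])
      rw [hlen, hsσ, show F.len i - 1 = l + m by omega] at h2
      refine mul_left_cancel₀ (phase_ne_zero (F.len i)) ?_
      have h3 : conj (κ i * (-1) ^ l) = κ i * (-1) ^ l := by simp [hκ]
      have h4 : ((-1 : ℂ) ^ (l + m)) = (-1) ^ l * (-1) ^ m := pow_add _ _ _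
      rw [h1, h3]
      rw [h4] at h2
      linear_combination (κ i * (-1) ^ m * (κ i * (-1) ^ l)) * h2 +
        ((-1) ^ l * ((F.sign i : ℤ) : ℂ)) * (hκκ i * ((-1) ^ m * (-1) ^ m * (-1) ^ l * (-1) ^ l) +
          hsq m * ((-1) ^ l * (-1) ^ l) + hsq l)
    · rw [F.orth i k l m hik, F.orth (σ i) (σ k) l m, mul_zero, mul_zero]
      rintro ⟨h1, h2⟩
      refine hik ⟨?_, by rw [hlen] at h2; exact h2⟩
      rw [← hσ i, h1, hσ]

end Reversal

/-! ### The triple attached to a chain basis -/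

section Triple

variable {V : Type*} [AddCommGroup V] [Module ℂ V]
  {B : V →ₗ⋆[ℂ] V →ₗ[ℂ] ℂ} {X : Module.End ℂ V} {ι : Type*}

namespace ChainBasis

/-- The neutral element of the `𝔰𝔩₂`-triple attached to a chain basis. -/
noncomputable def opH (F : ChainBasis B X ⊤ ι) (hX : ∀ x y, B (X x) y = -B x (X y)) :
    Module.End ℂ V :=
  F.lift hX fun i l => (2 * l + 1 - F.len i : ℤ) • (X ^ l) (F.vec i)

/-- The lowering element of the `𝔰𝔩₂`-triple attached to a chain basis. -/
noncomputable def opY (F : ChainBasis B X ⊤ ι) (hX : ∀ x y, B (X x) y = -B x (X y)) :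
    Module.End ℂ V :=
  F.lift hX fun i l => (l * (F.len i - l) : ℤ) • (X ^ (l - 1)) (F.vec i)

variable (F : ChainBasis B X ⊤ ι) (hX : ∀ x y, B (X x) y = -B x (X y))

lemma opH_apply (i : ι) (l : ℕ) : F.opH hX ((X ^ l) (F.vec i)) =
    (2 * l + 1 - F.len i : ℤ) • (X ^ l) (F.vec i) := by
  by_cases h : l < F.len i
  · exact F.lift_apply hX _ h
  · rw [F.pow_eq_zero i (not_lt.mp h)]; simp

lemma opY_vec (i : ι) : F.opY hX (F.vec i) = 0 := by
  have := F.lift_apply hX (fun i l => (l * (F.len i - l) : ℤ) • (X ^ (l - 1)) (F.vec i))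
    (F.len_pos i)
  simpa [opY] using this

lemma opY_apply (i : ι) (l : ℕ) : F.opY hX ((X ^ (l + 1)) (F.vec i)) =
    ((l + 1) * (F.len i - l - 1) : ℤ) • (X ^ l) (F.vec i) := by
  by_cases h : l + 1 < F.len i
  · refine (F.lift_apply hX _ h).trans ?_
    rw [Nat.add_sub_cancel]
    congr 1
    push_cast
    ring
  · rw [F.pow_eq_zero i (not_lt.mp h), map_zero]
    by_cases h' : l + 1 = F.len i
    · rw [← h']; simp
    · rw [F.pow_eq_zero i (by omega), smul_zero]

lemma X_pow_apply (l : ℕ) (x : V) : X ((X ^ l) x) = (X ^ (l + 1)) x := by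
  rw [pow_succ', Module.End.mul_apply]

lemma opH_X_sub : F.opH hX * X - X * F.opH hX = 2 • X := by
  refine F.hom_ext fun i l _ => ?_
  simp only [LinearMap.sub_apply, Module.End.mul_apply, opH_apply, X_pow_apply, map_zsmul,
    LinearMap.smul_apply]
  rw [← sub_smul, ← natCast_zsmul]
  congr 1
  push_cast
  ring

lemma X_opY_sub : X * F.opY hX - F.opY hX * X = F.opH hX := by
  refine F.hom_ext fun i l _ => ?_
  simp only [LinearMap.sub_apply, Module.End.mul_apply, X_pow_apply, opY_apply, opH_apply]
  cases l with
  | zero =>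
    rw [pow_zero, Module.End.one_apply, opY_vec, map_zero, zero_sub, ← neg_smul]
    congr 1
    push_cast
    ring
  | succ l =>
    rw [opY_apply, map_zsmul, X_pow_apply, ← sub_smul]
    congr 1
    push_cast
    ring

lemma opH_opY_sub : F.opH hX * F.opY hX - F.opY hX * F.opH hX = -(2 • F.opY hX) := by
  refine F.hom_ext fun i l _ => ?_
  simp only [LinearMap.sub_apply, Module.End.mul_apply, LinearMap.neg_apply, LinearMap.smul_apply,
    opH_apply, map_zsmul]
  cases l with
  | zero => rw [pow_zero, Module.End.one_apply, opY_vec]; simp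
  | succ l =>
    rw [opY_apply, map_zsmul, opH_apply, ← natCast_zsmul, smul_smul, smul_smul, smul_smul,
      ← sub_smul, ← neg_smul]
    congr 1
    push_cast
    ring

lemma opH_skew (x y : V) : B (F.opH hX x) y = -B x (F.opH hX y) := by
  suffices H : B.comp (F.opH hX) = -(B.compl₂ (F.opH hX)) from
    DFunLike.congr_fun (DFunLike.congr_fun H x) y
  refine F.form_ext fun i k l m hl hm => ?_
  simp only [LinearMap.comp_apply, LinearMap.neg_apply, LinearMap.compl₂_apply, opH_apply,
    map_zsmul, LinearMap.smul_apply]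
  by_cases h : i = k ∧ l + m + 1 = F.len i
  · obtain ⟨rfl, h⟩ := h
    rw [← neg_smul]
    congr 1
    omega
  · rw [F.orth i k l m h]; simp

lemma opY_skew (x y : V) : B (F.opY hX x) y = -B x (F.opY hX y) := by
  suffices H : B.comp (F.opY hX) = -(B.compl₂ (F.opY hX)) from
    DFunLike.congr_fun (DFunLike.congr_fun H x) y
  refine F.form_ext fun i k l m hl hm => ?_
  simp only [LinearMap.comp_apply, LinearMap.neg_apply, LinearMap.compl₂_apply]
  -- both sides vanish unless `i = k` and `l + m = len i`
  rcases l with _ | l <;> rcases m with _ | m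
  · simp [opY_vec]
  · rw [opY_apply, pow_zero, Module.End.one_apply, opY_vec, map_zsmul]
    by_cases h : i = k ∧ 0 + m + 1 = F.len i
    · obtain ⟨rfl, h⟩ := h; omega
    · have := F.orth i k 0 m h
      rw [pow_zero, Module.End.one_apply] at this
      simp [this]
  · rw [opY_apply, pow_zero, Module.End.one_apply, opY_vec, map_zsmul, LinearMap.smul_apply]
    by_cases h : i = k ∧ l + 0 + 1 = F.len i
    · obtain ⟨rfl, h⟩ := h; omega
    · have := F.orth i k l 0 h
      rw [pow_zero, Module.End.one_apply] at this
      simp [this]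
  · rw [opY_apply, opY_apply, map_zsmul, LinearMap.smul_apply, map_zsmul]
    have h2 : B ((X ^ (l + 1)) (F.vec i)) ((X ^ m) (F.vec k)) =
        -B ((X ^ l) (F.vec i)) ((X ^ (m + 1)) (F.vec k)) := by
      rw [← X_pow_apply, hX, X_pow_apply]
    rw [h2, smul_neg, neg_neg]
    by_cases h : i = k ∧ l + (m + 1) + 1 = F.len i
    · obtain ⟨rfl, h⟩ := h
      congr 1
      rw [← h]
      push_cast
      ring
    · rw [F.orth i k l (m + 1) h]; simp

lemma coeff_opH (i : ι) (z : V) :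
    F.coeff hX i 0 (F.opH hX z) = ((1 - F.len i : ℤ) : ℂ) * F.coeff hX i 0 z := by
  classical
  suffices H : F.coeff hX i 0 ∘ₗ F.opH hX = ((1 - F.len i : ℤ) : ℂ) • F.coeff hX i 0 from
    DFunLike.congr_fun H z
  refine F.hom_ext fun k m hm => ?_
  simp only [LinearMap.comp_apply, LinearMap.smul_apply, opH_apply, map_zsmul,
    F.coeff_pow_vec hX hm]
  split_ifs with h
  · obtain ⟨rfl, rfl⟩ := h
    simp
  · simp

lemma coeff_opY {i : ι} {l : ℕ} (z : V) : F.coeff hX i l (F.opY hX z) =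
    (((l + 1) * (F.len i - l - 1) : ℤ) : ℂ) * F.coeff hX i (l + 1) z := by
  classical
  suffices H : F.coeff hX i l ∘ₗ F.opY hX =
      (((l + 1) * (F.len i - l - 1) : ℤ) : ℂ) • F.coeff hX i (l + 1) from
    DFunLike.congr_fun H z
  refine F.hom_ext fun k m hm => ?_
  simp only [LinearMap.comp_apply, LinearMap.smul_apply, F.coeff_pow_vec hX hm]
  cases m with
  | zero => rw [pow_zero, Module.End.one_apply, opY_vec]; simp
  | succ m =>
    rw [opY_apply, map_zsmul, F.coeff_pow_vec hX (by omega)]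
    split_ifs with h h' h'
    · obtain ⟨rfl, rfl⟩ := h
      simp
    · exact absurd ⟨h.1, by omega⟩ h'
    · exact absurd ⟨h'.1, by omega⟩ h
    · simp

/-- The span of the generators of the chains of length `e`. -/
def generators (e : ℕ) : Submodule ℂ V := Submodule.span ℂ (F.vec '' {i | F.len i = e})

lemma vec_mem_generators (i : ι) : F.vec i ∈ F.generators (F.len i) :=
  Submodule.subset_span ⟨i, rfl, rfl⟩

variable {F}

lemma generators_pow {e : ℕ} {w : V} (hw : w ∈ F.generators e) : (X ^ e) w = 0 := by
  have : F.generators e ≤ LinearMap.ker (X ^ e) := by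
    refine Submodule.span_le.mpr ?_
    rintro _ ⟨i, rfl, rfl⟩
    exact F.pow_len i
  exact this hw

lemma generators_opH {e : ℕ} {w : V} (hw : w ∈ F.generators e) (l : ℕ) :
    F.opH hX ((X ^ l) w) = (2 * l + 1 - e : ℤ) • (X ^ l) w := by
  have : F.generators e ≤ LinearMap.ker (F.opH hX ∘ₗ X ^ l - (2 * l + 1 - e : ℤ) • X ^ l) := by
    refine Submodule.span_le.mpr ?_
    rintro _ ⟨i, rfl, rfl⟩
    have := F.opH_apply hX i l
    simp only [SetLike.mem_coe, LinearMap.mem_ker, LinearMap.sub_apply, LinearMap.comp_apply,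
      LinearMap.smul_apply]
    rw [this, sub_self]
  exact sub_eq_zero.mp (this hw)

lemma generators_opY_self {e : ℕ} {w : V} (hw : w ∈ F.generators e) : F.opY hX w = 0 := by
  have : F.generators e ≤ LinearMap.ker (F.opY hX) := by
    refine Submodule.span_le.mpr ?_
    rintro _ ⟨i, rfl, rfl⟩
    exact F.opY_vec hX i
  exact this hw

lemma generators_opY {e : ℕ} {w : V} (hw : w ∈ F.generators e) (l : ℕ) :
    F.opY hX ((X ^ (l + 1)) w) = ((l + 1) * (e - l - 1) : ℤ) • (X ^ l) w := by
  have : F.generators e ≤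
      LinearMap.ker (F.opY hX ∘ₗ X ^ (l + 1) - ((l + 1) * (e - l - 1) : ℤ) • X ^ l) := by
    refine Submodule.span_le.mpr ?_
    rintro _ ⟨i, rfl, rfl⟩
    have := F.opY_apply hX i l
    simp only [SetLike.mem_coe, LinearMap.mem_ker, LinearMap.sub_apply, LinearMap.comp_apply,
      LinearMap.smul_apply]
    rw [this, sub_self]
  exact sub_eq_zero.mp (this hw)

lemma generators_pow_ne_zero (hX : ∀ x y, B (X x) y = -B x (X y)) {e : ℕ} {w : V}
    (hw : w ∈ F.generators e) (hw0 : w ≠ 0) {l : ℕ} (hl : l < e) : (X ^ l) w ≠ 0 := by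
  induction l with
  | zero => simpa
  | succ l ih =>
    intro h
    have h1 := generators_opY hX hw l
    rw [h, map_zero, eq_comm, ← Int.cast_smul_eq_zsmul ℂ, smul_eq_zero, Int.cast_eq_zero] at h1
    refine h1.elim (fun h2 => ?_) (ih (by omega))
    rcases mul_eq_zero.mp h2 with h3 | h3 <;> omega

/-- A vector killed by the lowering operator is a combination of generators. -/
lemma sum_coeff_of_opY [Fintype ι] {z : V} (hz : F.opY hX z = 0) :
    ∑ i, F.coeff hX i 0 z • F.vec i = z := by
  conv_rhs => rw [← F.sum_coeff hX z]
  refine Finset.sum_congr rfl fun i _ => ?_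
  rw [Finset.sum_eq_single_of_mem 0 (Finset.mem_range.mpr (F.len_pos i))]
  · simp
  · intro l hl hl0
    rw [Finset.mem_range] at hl
    obtain ⟨l, rfl⟩ := Nat.exists_eq_succ_of_ne_zero hl0
    have h := F.coeff_opY hX (i := i) (l := l) z
    rw [hz, map_zero, eq_comm, mul_eq_zero, Int.cast_eq_zero, mul_eq_zero] at h
    rw [Nat.succ_eq_add_one] at *
    rw [h.resolve_left (by omega), zero_smul]

lemma mem_generators_of_coeff [Fintype ι] {e : ℕ} {z : V} (hz : F.opY hX z = 0)
    (h : ∀ i, F.len i ≠ e → F.coeff hX i 0 z = 0) : z ∈ F.generators e := by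
  rw [← sum_coeff_of_opY hX hz]
  refine Submodule.sum_mem _ fun i _ => ?_
  by_cases hi : F.len i = e
  · exact Submodule.smul_mem _ _ (hi ▸ F.vec_mem_generators i)
  · rw [h i hi, zero_smul]; exact Submodule.zero_mem _

end ChainBasis
end Triple

/-! ### Real submodules -/

section RealSubmodules

variable {V : Type*} [AddCommGroup V] [Module ℂ V] [Module ℝ V]
  {B : V →ₗ⋆[ℂ] V →ₗ[ℂ] ℂ} {X : Module.End ℂ V} {ι : Type*}

namespace ChainBasis

variable {F : ChainBasis B X ⊤ ι} (hX : ∀ x y, B (X x) y = -B x (X y))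

/-- The real span of the chain `w, X w, …, X ^ (e - 1) w`. -/
def chainSpan (X : Module.End ℂ V) (e : ℕ) (w : V) : Submodule ℝ V :=
  Submodule.span ℝ (Set.range fun l : Fin e => (X ^ (l : ℕ)) w)

lemma pow_mem_chainSpan {e : ℕ} {w : V} (hw : (X ^ e) w = 0) (l : ℕ) :
    (X ^ l) w ∈ chainSpan X e w := by
  by_cases h : l < e
  · exact Submodule.subset_span ⟨⟨l, h⟩, rfl⟩
  · obtain ⟨k, rfl⟩ := Nat.exists_eq_add_of_le' (not_lt.mp h)
    rw [← pow_apply_pow, hw, map_zero]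
    exact Submodule.zero_mem _

lemma chainSpan_le {e : ℕ} {w : V} {P : Submodule ℝ V} (h : ∀ l, (X ^ l) w ∈ P) :
    chainSpan X e w ≤ P := by
  refine Submodule.span_le.mpr ?_
  rintro _ ⟨l, rfl⟩
  exact h l

variable [IsScalarTower ℝ ℂ V]

lemma chainSpan_stable {e : ℕ} {w : V} (hw : w ∈ F.generators e) :
    ∀ z ∈ chainSpan X e w, X z ∈ chainSpan X e w ∧ F.opH hX z ∈ chainSpan X e w ∧
      F.opY hX z ∈ chainSpan X e w := by
  have h0 := pow_mem_chainSpan (generators_pow hw)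
  refine fun z hz => ⟨?_, ?_, ?_⟩
  · refine (chainSpan_le (P := (chainSpan X e w).comap (X.restrictScalars ℝ)) fun l => ?_) hz
    simp only [Submodule.mem_comap, LinearMap.restrictScalars_apply, X_pow_apply, h0]
  · refine (chainSpan_le (P := (chainSpan X e w).comap ((F.opH hX).restrictScalars ℝ))
      fun l => ?_) hz
    simp only [Submodule.mem_comap, LinearMap.restrictScalars_apply, generators_opH hX hw]
    exact zsmul_mem (h0 l) _
  · refine (chainSpan_le (P := (chainSpan X e w).comap ((F.opY hX).restrictScalars ℝ))
      fun l => ?_) hz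
    simp only [Submodule.mem_comap, LinearMap.restrictScalars_apply]
    cases l with
    | zero =>
      rw [pow_zero, Module.End.one_apply, generators_opY_self hX hw]
      exact Submodule.zero_mem _
    | succ l =>
      rw [generators_opY hX hw]
      exact zsmul_mem (h0 l) _

lemma finrank_chainSpan (hX : ∀ x y, B (X x) y = -B x (X y)) {e : ℕ} {w : V}
    (hw : w ∈ F.generators e) (hw0 : w ≠ 0) :
    Module.finrank ℝ (chainSpan X e w) = e := by
  -- the vectors of the chain are eigenvectors of `H` for distinct eigenvalues
  have h : LinearIndependent ℂ fun l : Fin e => (X ^ (l : ℕ)) w := by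
    refine Module.End.eigenvectors_linearIndependent' (F.opH hX)
      (fun l : Fin e => ((2 * (l : ℕ) + 1 - e : ℤ) : ℂ)) ?_ _ fun l => ?_
    · intro l m hlm
      have := Int.cast_injective hlm
      ext
      omega
    · refine ⟨Module.End.mem_eigenspace_iff.mpr ?_, generators_pow_ne_zero hX hw hw0 l.2⟩
      rw [generators_opH hX hw, Int.cast_smul_eq_zsmul]
  have h' : LinearIndependent ℝ fun l : Fin e => (X ^ (l : ℕ)) w :=
    h.restrict_scalars (by
      intro a b hab
      simpa using hab)
  rw [chainSpan, finrank_span_eq_card h', Fintype.card_fin]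

/-- The Casimir element acts on a chain of length `e` by the scalar `e ^ 2 - 1`. -/
lemma casimir_chainSpan {e : ℕ} {w : V} (hw : w ∈ F.generators e) {z : V}
    (hz : z ∈ chainSpan X e w) :
    F.opH hX (F.opH hX z) - 2 • F.opH hX z + 4 • X (F.opY hX z) = ((e : ℤ) ^ 2 - 1) • z := by
  have : chainSpan X e w ≤ LinearMap.ker ((F.opH hX * F.opH hX - 2 • F.opH hX +
      4 • (X * F.opY hX) - ((e : ℤ) ^ 2 - 1) • (1 : Module.End ℂ V)).restrictScalars ℝ) := by
    refine chainSpan_le fun l => LinearMap.mem_ker.mpr ?_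
    simp only [LinearMap.restrictScalars_apply, LinearMap.sub_apply, LinearMap.add_apply,
      Module.End.mul_apply, LinearMap.smul_apply, Module.End.one_apply, generators_opH hX hw,
      map_zsmul]
    cases l with
    | zero =>
      rw [pow_zero, Module.End.one_apply, generators_opY_self hX hw, map_zero, smul_zero, add_zero,
        ← natCast_zsmul, smul_smul, smul_smul, ← sub_smul, ← sub_smul]
      convert zero_smul ℤ w
      push_cast
      ring
    | succ l =>
      rw [generators_opY hX hw, map_zsmul, X_pow_apply, ← natCast_zsmul, ← natCast_zsmul, smul_smul,
        smul_smul, smul_smul, ← sub_smul, ← add_smul, ← sub_smul]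
      convert zero_smul ℤ _
      push_cast
      ring
  exact sub_eq_zero.mp (this hz)

/-- Every nonzero real subspace stable under the triple contains a lowest weight vector. -/
lemma exists_generator_mem [FiniteDimensional ℝ V] [Fintype ι] {W : Submodule ℝ V} (hW : W ≠ ⊥)
    (hst : ∀ z ∈ W, X z ∈ W ∧ F.opH hX z ∈ W ∧ F.opY hX z ∈ W) :
    ∃ e, ∃ w ∈ W, w ≠ 0 ∧ w ∈ F.generators e := by
  -- the lowering operator is nilpotent, so it has a nonzero kernel on `W`
  obtain ⟨N, hN⟩ : ∃ N, (F.opY hX) ^ N = 0 := by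
    obtain ⟨N, hN⟩ : ∃ N, ∀ i, F.len i ≤ N :=
      ⟨∑ i, F.len i, fun i => Finset.single_le_sum (fun _ _ => Nat.zero_le _) (Finset.mem_univ i)⟩
    have key : ∀ l i, ((F.opY hX) ^ (l + 1)) ((X ^ l) (F.vec i)) = 0 := by
      intro l
      induction l with
      | zero => intro i; simp [opY_vec]
      | succ l ih =>
        intro i
        rw [pow_succ, Module.End.mul_apply, opY_apply, map_zsmul, ih, smul_zero]
    refine ⟨N, F.hom_ext fun i l hl => ?_⟩
    have := hN i
    obtain ⟨k, hk⟩ := Nat.exists_eq_add_of_le' (show l + 1 ≤ N by omega)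
    rw [hk, ← pow_apply_pow, key, map_zero, LinearMap.zero_apply]
  obtain ⟨w, hwW, hw0⟩ := W.ne_bot_iff.mp hW
  classical
  have hex : ∃ k, ((F.opY hX) ^ k) w = 0 := ⟨N, by rw [hN]; rfl⟩
  have hmem : ∀ k, ((F.opY hX) ^ k) w ∈ W := by
    intro k
    induction k with
    | zero => simpa
    | succ k ih => rw [pow_succ', Module.End.mul_apply]; exact (hst _ ih).2.2
  obtain ⟨k, hk⟩ := Nat.exists_eq_succ_of_ne_zero (n := Nat.find hex) (fun h => hw0 (by
    have := Nat.find_spec hex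
    rw [h] at this
    simpa using this))
  have hu0 : ((F.opY hX) ^ k) w ≠ 0 := Nat.find_min hex (by omega)
  have hu : F.opY hX (((F.opY hX) ^ k) w) = 0 := by
    have := Nat.find_spec hex
    rwa [hk, Nat.succ_eq_add_one, pow_succ', Module.End.mul_apply] at this
  -- this kernel is stable under the diagonalizable operator `H`, hence contains an eigenvector
  let HR : Module.End ℝ V := (F.opH hX).restrictScalars ℝ
  let K : Submodule ℝ V := W ⊓ LinearMap.ker ((F.opY hX).restrictScalars ℝ)
  have hKst : ∀ z ∈ K, HR z ∈ K := by
    rintro z ⟨hz, hz'⟩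
    refine ⟨(hst z hz).2.1, ?_⟩
    have h1 := LinearMap.congr_fun (F.opH_opY_sub hX) z
    have h2 : F.opY hX z = 0 := hz'
    simp only [LinearMap.sub_apply, Module.End.mul_apply, LinearMap.neg_apply,
      LinearMap.smul_apply, h2, map_zero, smul_zero, neg_zero, zero_sub, neg_eq_zero] at h1
    exact h1
  have htop : ⨆ μ, HR.genEigenspace μ 1 = ⊤ := by
    rw [eq_top_iff]
    intro z _
    rw [← F.sum_coeff hX z]
    refine Submodule.sum_mem _ fun i _ => Submodule.sum_mem _ fun l _ => ?_
    refine Submodule.mem_iSup_of_mem ((2 * l + 1 - F.len i : ℤ) : ℝ) ?_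
    refine Module.End.mem_eigenspace_iff.mpr ?_
    simp only [HR, LinearMap.restrictScalars_apply, map_smul, opH_apply]
    rw [Int.cast_smul_eq_zsmul, smul_comm]
  have hK := Submodule.inf_iSup_genEigenspace hKst 1
  rw [htop, inf_top_eq] at hK
  obtain ⟨μ, hμ⟩ : ∃ μ, K ⊓ HR.genEigenspace μ 1 ≠ ⊥ := by
    by_contra! h
    have h1 : K = ⊥ := by rw [hK]; simp [h]
    exact hu0 ((Submodule.eq_bot_iff K).mp h1 _ ⟨hmem k, hu⟩)
  obtain ⟨v, ⟨⟨hvW, hvY⟩, hvH⟩, hv0⟩ := (Submodule.ne_bot_iff _).mp hμ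
  have hvY : F.opY hX v = 0 := hvY
  have hvH : F.opH hX v = μ • v := Module.End.mem_eigenspace_iff.mp hvH
  have hc : ∀ i, F.coeff hX i 0 v ≠ 0 → (1 - F.len i : ℤ) = μ := by
    intro i hi
    have h1 := F.coeff_opH hX i v
    rw [hvH, ← algebraMap_smul ℂ μ v, map_smul, smul_eq_mul] at h1
    have h2 := mul_right_cancel₀ hi h1
    rw [Complex.coe_algebraMap] at h2
    exact_mod_cast h2.symm
  obtain ⟨i, hi⟩ : ∃ i, F.coeff hX i 0 v ≠ 0 := by
    by_contra! h
    refine hv0 ?_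
    rw [← sum_coeff_of_opY hX hvY]
    simp [h]
  refine ⟨F.len i, v, hvW, hv0, mem_generators_of_coeff hX hvY fun j hj => ?_⟩
  by_contra h
  have h1 := (hc j h).trans (hc i hi).symm
  have h2 := Int.cast_injective h1
  omega

/-- The chain of a generator is an irreducible real module. -/
lemma eq_chainSpan_of_le [FiniteDimensional ℝ V] [Fintype ι] {e : ℕ} {w : V}
    (hw : w ∈ F.generators e) (hw0 : w ≠ 0) {U : Submodule ℝ V} (hU : U ≠ ⊥)
    (hst : ∀ z ∈ U, X z ∈ U ∧ F.opH hX z ∈ U ∧ F.opY hX z ∈ U) (hle : U ≤ chainSpan X e w) :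
    U = chainSpan X e w := by
  obtain ⟨e', u, huU, hu0, hu⟩ := exists_generator_mem hX hU hst
  have hpow : ∀ l, (X ^ l) u ∈ U := by
    intro l
    induction l with
    | zero => simpa
    | succ l ih => rw [← X_pow_apply]; exact (hst _ ih).1
  have hu' : u ∈ chainSpan X e' u := by
    have := pow_mem_chainSpan (X := X) (generators_pow hu) 0
    simpa using this
  -- the Casimir element identifies the length of the chain of `u`
  have hee : e' = e := by
    have h1 := (casimir_chainSpan hX hu hu').symm.trans (casimir_chainSpan hX hw (hle huU))
    rw [← Int.cast_smul_eq_zsmul ℂ, ← Int.cast_smul_eq_zsmul ℂ] at h1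
    have h2 := Int.cast_injective (smul_left_injective ℂ hu0 h1)
    have h3 : (e' : ℤ) ^ 2 = (e : ℤ) ^ 2 := by omega
    exact_mod_cast (sq_eq_sq₀ (by positivity) (by positivity)).mp h3
  subst hee
  have hle' : chainSpan X e' u ≤ U := chainSpan_le hpow
  refine le_antisymm hle ?_
  rw [← Submodule.eq_of_le_of_finrank_eq (hle'.trans hle)
    ((finrank_chainSpan hX hu hu0).trans (finrank_chainSpan hX hw hw0).symm)]
  exact hle'

end ChainBasis
end RealSubmodules

/-! ### Signed Young diagrams -/

section Diagrams

/-- The signed row of length `d` with first sign `ε`. -/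
def signedRow (d : ℕ) (ε : ℤˣ) : List ℤˣ :=
  List.ofFn fun l : Fin d => ε * (-1) ^ (if d % 4 = 3 ∧ (l : ℕ) + 1 = d then (l : ℕ) - 1 else l)

lemma isSignedRow_signedRow {d : ℕ} (hd : 0 < d) (ε : ℤˣ) : IsSignedRow (signedRow d ε) := by
  refine ⟨fun h => ?_, fun l h => ?_⟩
  · have := congrArg List.length h
    simp [signedRow] at this
    omega
  · simp only [signedRow, List.length_ofFn] at h
    simp only [signedRow, List.length_ofFn, List.getElem_ofFn]
    have h1 : ¬ (d % 4 = 3 ∧ l + 1 = d) := by omega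
    by_cases h2 : d % 4 = 3 ∧ l + 2 = d
    · rw [if_pos h2, if_pos (by omega), if_neg h1, Nat.add_sub_cancel]
    · rw [if_neg h2, if_neg (by omega), if_neg h1, pow_succ, mul_neg_one, mul_neg]

lemma length_signedRow (d : ℕ) (ε : ℤˣ) : (signedRow d ε).length = d := by simp [signedRow]

lemma head?_signedRow {d : ℕ} (hd : 0 < d) (ε : ℤˣ) : (signedRow d ε).head? = some ε := by
  obtain ⟨n, rfl⟩ := Nat.exists_eq_succ_of_ne_zero hd.ne'
  simp [signedRow, List.ofFn_succ]

/-- A signed row is determined by its length and its first sign. -/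
lemma IsSignedRow.eq_of_head? {r s : List ℤˣ} (hr : IsSignedRow r) (hs : IsSignedRow s)
    (hlen : r.length = s.length) (hhead : r.head? = s.head?) : r = s := by
  refine List.ext_getElem hlen fun n => ?_
  induction n with
  | zero =>
    intro h1 h2
    rw [List.head?_eq_getElem?, List.head?_eq_getElem?, List.getElem?_eq_getElem h1,
      List.getElem?_eq_getElem h2] at hhead
    exact Option.some_injective _ hhead
  | succ n ih =>
    intro h1 h2
    rw [hr.2 n h1, hs.2 n h2, hlen, ih (by omega) (by omega)]

/-- A signed Young diagram is determined by the numbers of its rows with given length and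
first sign. -/
lemma SignedYoungDiagram.ext_counts {D E : SignedYoungDiagram}
    (hp : ∀ d, D.plusCount d = E.plusCount d) (hm : ∀ d, D.minusCount d = E.minusCount d) :
    D = E := by
  refine SignedYoungDiagram.ext (Multiset.ext.mpr fun r => ?_)
  by_cases hr : IsSignedRow r
  · have key : ∀ G : SignedYoungDiagram, G.rows.count r =
        G.rows.countP fun a => a.length = r.length ∧ a.head? = r.head? := by
      intro G
      refine Multiset.countP_congr rfl fun a ha => ?_
      rw [eq_iff_iff]
      exact ⟨fun h => h ▸ ⟨rfl, rfl⟩,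
        fun h => hr.eq_of_head? (G.isSignedRow a ha) h.1.symm h.2.symm⟩
    rw [key, key]
    obtain ⟨ε, hε⟩ : ∃ ε, r.head? = some ε := ⟨_, List.head?_eq_some_head hr.1⟩
    rw [hε]
    rcases Int.units_eq_one_or ε with rfl | rfl
    · exact hp r.length
    · exact hm r.length
  · rw [Multiset.count_eq_zero_of_notMem fun h => hr (D.isSignedRow r h),
      Multiset.count_eq_zero_of_notMem fun h => hr (E.isSignedRow r h)]

/-- The signed Young diagram with rows of lengths `len i` and first signs `sign i`. -/
def SignedYoungDiagram.ofRows {ι : Type*} [Fintype ι] (len : ι → ℕ) (sign : ι → ℤˣ)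
    (h : ∀ i, 0 < len i) : SignedYoungDiagram where
  rows := Finset.univ.val.map fun i => signedRow (len i) (sign i)
  isSignedRow := by
    intro r hr
    obtain ⟨i, -, rfl⟩ := Multiset.mem_map.mp hr
    exact isSignedRow_signedRow (h i) _

lemma SignedYoungDiagram.countP_ofRows {ι : Type*} [Fintype ι] (len : ι → ℕ) (sign : ι → ℤˣ)
    (h : ∀ i, 0 < len i) (d : ℕ) (ε : ℤˣ) :
    (SignedYoungDiagram.ofRows len sign h).rows.countP
      (fun r => r.length = d ∧ r.head? = some ε) = Nat.card {i // len i = d ∧ sign i = ε} := by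
  classical
  rw [SignedYoungDiagram.ofRows, Multiset.countP_map, Nat.card_eq_fintype_card,
    Fintype.card_subtype, Finset.card_def, Finset.filter_val]
  congr 1
  refine Multiset.filter_congr fun i _ => ?_
  rw [length_signedRow, head?_signedRow (h i), Option.some_inj]

end Diagrams

/-! ### The Hermitian form and elements of the Lie algebra -/

section Matrices

variable {p q : ℕ}

/-- The Hermitian form of signature `(p, q)` as a sesquilinear map. -/
noncomputable def hermSesq (p q : ℕ) : PQVec p q →ₗ⋆[ℂ] PQVec p q →ₗ[ℂ] ℂ :=
  LinearMap.mk₂'ₛₗ (starRingEnd ℂ) (RingHom.id ℂ) hermForm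
    (fun x y z => by simp [hermForm, add_dotProduct])
    (fun c x y => by simp [hermForm])
    (fun x y z => by simp [hermForm, Matrix.mulVec_add])
    (fun c x y => by simp [hermForm, Matrix.mulVec_smul])

@[simp] lemma hermSesq_apply (x y : PQVec p q) : hermSesq p q x y = hermForm x y := rfl

lemma Ipq_conjTranspose : (Ipq p q)ᴴ = Ipq p q := by
  rw [Ipq, LieAlgebra.Orthogonal.indefiniteDiagonal, Matrix.diagonal_conjTranspose]
  congr 1
  ext (i | i) <;> simp

lemma Ipq_mul_self : Ipq p q * Ipq p q = 1 := by
  rw [Ipq, LieAlgebra.Orthogonal.indefiniteDiagonal, Matrix.diagonal_mul_diagonal,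
    ← Matrix.diagonal_one]
  congr 1
  ext (i | i) <;> simp

lemma conj_hermSesq (x y : PQVec p q) : conj (hermSesq p q x y) = hermSesq p q y x := by
  simp only [hermSesq_apply, hermForm, starRingEnd_apply]
  rw [Matrix.star_dotProduct, star_star, Matrix.star_mulVec, Ipq_conjTranspose,
    Matrix.dotProduct_mulVec]

open scoped ComplexOrder in
lemma hermSesq_nondegenerate (x : PQVec p q) (h : ∀ y, hermSesq p q x y = 0) : x = 0 := by
  have := h (Ipq p q *ᵥ x)
  rw [hermSesq_apply, hermForm, Matrix.mulVec_mulVec, Ipq_mul_self, Matrix.one_mulVec] at this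
  exact dotProduct_star_self_eq_zero.mp this

lemma hermForm_mulVec (A C : PQMat p q) (x y : PQVec p q) :
    hermForm (A *ᵥ x) (C *ᵥ y) = star x ⬝ᵥ ((Aᴴ * Ipq p q * C) *ᵥ y) := by
  rw [hermForm, Matrix.star_mulVec, ← Matrix.dotProduct_mulVec, Matrix.mulVec_mulVec,
    Matrix.mulVec_mulVec]

lemma matrix_eq_of_dotProduct {n : Type*} [Fintype n] {A C : Matrix n n ℂ}
    (h : ∀ x y, star x ⬝ᵥ (A *ᵥ y) = star x ⬝ᵥ (C *ᵥ y)) : A = C := by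
  classical
  refine Matrix.ext_of_mulVec_single fun i => ?_
  refine (dotProduct_eq _ _ fun u => ?_)
  have := h (star u) (Pi.single i 1)
  rw [star_star] at this
  rw [dotProduct_comm, this, dotProduct_comm]

lemma su_skew (X : su p q) (x y : PQVec p q) :
    hermSesq p q (Matrix.toLin' (X : PQMat p q) x) y =
      -hermSesq p q x (Matrix.toLin' (X : PQMat p q) y) := by
  have h1 := hermForm_mulVec (X : PQMat p q) 1 x y
  have h2 := hermForm_mulVec 1 (X : PQMat p q) x y
  have h3 : (X : PQMat p q)ᴴ * Ipq p q = -(Ipq p q * X) := eq_neg_of_add_eq_zero_left X.2.1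
  simp only [Matrix.one_mulVec, mul_one, Matrix.conjTranspose_one, one_mul] at h1 h2
  rw [hermSesq_apply, hermSesq_apply, Matrix.toLin'_apply, Matrix.toLin'_apply, h1, h2, h3,
    Matrix.neg_mulVec, dotProduct_neg]

lemma toMatrix'_mem_su {f : Module.End ℂ (PQVec p q)}
    (h : ∀ x y, hermSesq p q (f x) y = -hermSesq p q x (f y))
    (htr : (LinearMap.toMatrix' f).trace = 0) : LinearMap.toMatrix' f ∈ su p q := by
  refine ⟨?_, htr⟩
  refine matrix_eq_of_dotProduct fun x y => ?_
  have h1 := hermForm_mulVec (LinearMap.toMatrix' f) 1 x y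
  have h2 := hermForm_mulVec 1 (LinearMap.toMatrix' f) x y
  simp only [Matrix.one_mulVec, mul_one, Matrix.conjTranspose_one, one_mul] at h1 h2
  rw [Matrix.add_mulVec, dotProduct_add, ← h1, ← h2, LinearMap.toMatrix'_mulVec,
    LinearMap.toMatrix'_mulVec, ← hermSesq_apply, ← hermSesq_apply, h]
  simp

/-- The endomorphism of `ℂ^{p+q}` defined by an element of `𝔰𝔲(p,q)`. -/
noncomputable abbrev suEnd (X : su p q) : Module.End ℂ (PQVec p q) :=
  Matrix.toLin' (X : PQMat p q)

lemma suEnd_pow_apply (X : su p q) (l : ℕ) (x : PQVec p q) :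
    (suEnd X ^ l) x = (X : PQMat p q) ^ l *ᵥ x := by
  rw [← Matrix.toLin'_apply, Matrix.toLin'_pow]

lemma exists_chainBasis_suEnd (X : su p q) (hnil : IsNilpotent (X : PQMat p q)) :
    ∃ (ι : Type) (_ : Finite ι), Nonempty (ChainBasis (hermSesq p q) (suEnd X) ⊤ ι) := by
  refine exists_chainBasis conj_hermSesq (su_skew X) ?_ ⊤ (fun _ _ => trivial)
    fun x _ h => hermSesq_nondegenerate x fun y => h y trivial
  obtain ⟨n, hn⟩ := hnil
  exact ⟨n, by rw [← Matrix.toLin'_pow, hn, map_zero]⟩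

/-- The lowest weight vectors in the sum of the irreducible real submodules of dimension `d` are
the combinations of the generators of the chains of length `d`. -/
lemma generators_eq_lowestWeight {X H Y : su p q} {ι : Type*} [Fintype ι]
    (F : ChainBasis (hermSesq p q) (suEnd X) ⊤ ι) (hH : suEnd H = F.opH (su_skew X))
    (hY : suEnd Y = F.opY (su_skew X)) (d : ℕ) :
    (F.generators d : Set (PQVec p q)) = lowestWeight X H Y d := by
  have hst : ∀ W : Submodule ℝ (PQVec p q), IsStable X H Y W ↔ ∀ z ∈ W, suEnd X z ∈ W ∧
      F.opH (su_skew X) z ∈ W ∧ F.opY (su_skew X) z ∈ W := by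
    intro W
    rw [← hH, ← hY]
    rfl
  have hY' : ∀ v, (Y : PQMat p q) *ᵥ v = F.opY (su_skew X) v := fun v => by rw [← hY]; rfl
  ext v
  simp only [SetLike.mem_coe, lowestWeight, Set.mem_ofPred_eq, hY']
  constructor
  · intro hv
    refine ⟨ChainBasis.generators_opY_self _ hv, ?_⟩
    by_cases hv0 : v = 0
    · rw [hv0]; exact Submodule.zero_mem _
    have hmem : v ∈ ChainBasis.chainSpan (suEnd X) d v := by
      simpa using ChainBasis.pow_mem_chainSpan (ChainBasis.generators_pow hv) 0
    have hirr : IsIrredSubmodule X H Y (ChainBasis.chainSpan (suEnd X) d v) := by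
      refine ⟨(hst _).mpr (ChainBasis.chainSpan_stable _ hv), fun h => hv0 ?_, fun U hU hUst => ?_⟩
      · rw [h] at hmem; simpa using hmem
      · by_cases hU0 : U = ⊥
        · exact Or.inl hU0
        · exact Or.inr (ChainBasis.eq_chainSpan_of_le (su_skew X) hv hv0 hU0 ((hst U).mp hUst) hU)
    have hle : ChainBasis.chainSpan (suEnd X) d v ≤ isotypical X H Y d :=
      le_sSup ⟨hirr, ChainBasis.finrank_chainSpan (su_skew X) hv hv0⟩
    exact hle hmem
  · rintro ⟨hv, hvM⟩
    refine ChainBasis.mem_generators_of_coeff (su_skew X) hv fun i hi => ?_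
    have hle : isotypical X H Y d ≤
        LinearMap.ker ((F.coeff (su_skew X) i 0).restrictScalars ℝ) := by
      refine sSup_le ?_
      rintro W ⟨⟨hWst, hW0, hWirr⟩, hWd⟩
      obtain ⟨e, w, hwW, hw0, hw⟩ :=
        ChainBasis.exists_generator_mem (su_skew X) hW0 ((hst W).mp hWst)
      have hpow : ∀ l, (suEnd X ^ l) w ∈ W := by
        intro l
        induction l with
        | zero => simpa
        | succ l ih => rw [← ChainBasis.X_pow_apply]; exact (hWst _ ih).1
      have hfin := ChainBasis.finrank_chainSpan (su_skew X) hw hw0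
      rcases hWirr _ (ChainBasis.chainSpan_le hpow)
        ((hst _).mpr (ChainBasis.chainSpan_stable _ hw)) with h | h
      · have hmem : w ∈ ChainBasis.chainSpan (suEnd X) e w := by
          simpa using ChainBasis.pow_mem_chainSpan (ChainBasis.generators_pow hw) 0
        rw [h] at hmem
        exact absurd (by simpa using hmem) hw0
      · have hed : e = d := by rw [← hfin, h, hWd]
        subst hed
        rw [← h]
        refine ChainBasis.chainSpan_le fun l => ?_
        have hgen : F.generators e ≤
            LinearMap.ker (F.coeff (su_skew X) i 0 ∘ₗ suEnd X ^ l) := by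
          classical
          refine Submodule.span_le.mpr ?_
          rintro _ ⟨k, rfl, rfl⟩
          simp only [SetLike.mem_coe, LinearMap.mem_ker, LinearMap.comp_apply]
          by_cases hl : l < F.len k
          · rw [F.coeff_pow_vec (su_skew X) hl, if_neg]
            rintro ⟨rfl, -⟩
            exact hi rfl
          · rw [F.pow_eq_zero k (not_lt.mp hl), map_zero]
        exact hgen hw
    exact hle hvM

end Matrices

/-! ### Normal bases -/

section NormalBases

variable {p q : ℕ}

/-- A chain basis for a nonzero `X` yields an `𝔰𝔩₂`-triple and a normal basis. -/
lemma ChainBasis.exists_normalBasis {X : su p q} (hX0 : X ≠ 0) {ι : Type*} [Finite ι]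
    (F : ChainBasis (hermSesq p q) (suEnd X) ⊤ ι) :
    ∃ H Y : su p q, IsSl2Triple H X Y ∧ Nonempty (NormalBasis X H Y) := by
  classical
  have := Fintype.ofFinite ι
  have hX := su_skew X
  have hmX : LinearMap.toMatrix' (suEnd X) = (X : PQMat p q) := LinearMap.toMatrix'_toLin' _
  have e1 := congrArg LinearMap.toMatrix' (F.X_opY_sub hX)
  have e2 := congrArg LinearMap.toMatrix' (F.opH_opY_sub hX)
  have e3 := congrArg LinearMap.toMatrix' (F.opH_X_sub hX)
  simp only [map_sub, LinearMap.toMatrix'_mul, map_neg, map_nsmul, hmX] at e1 e2 e3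
  have trH : (LinearMap.toMatrix' (F.opH hX)).trace = 0 := by
    rw [← e1, Matrix.trace_sub, Matrix.trace_mul_comm, sub_self]
  have trY : (LinearMap.toMatrix' (F.opY hX)).trace = 0 := by
    have := congrArg Matrix.trace e2
    rw [Matrix.trace_sub, Matrix.trace_mul_comm, sub_self, Matrix.trace_neg, Matrix.trace_smul,
      eq_comm, neg_eq_zero, smul_eq_zero] at this
    exact this.resolve_left two_ne_zero
  let H : su p q := ⟨_, toMatrix'_mem_su (F.opH_skew hX) trH⟩
  let Y : su p q := ⟨_, toMatrix'_mem_su (F.opY_skew hX) trY⟩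
  have hH : suEnd H = F.opH hX := Matrix.toLin'_toMatrix' _
  have hY : suEnd Y = F.opY hX := Matrix.toLin'_toMatrix' _
  have hHX : ⁅H, X⁆ = 2 • X := Subtype.ext e3
  refine ⟨H, Y, ⟨?_, Subtype.ext e1, hHX, Subtype.ext e2⟩, ?_⟩
  · intro h0
    rw [h0, zero_lie, ← Nat.cast_smul_eq_nsmul ℝ, eq_comm, smul_eq_zero] at hHX
    exact hX0 (hHX.resolve_left (by norm_num))
  -- enumerate the chains of each length
  let mult : ℕ → ℕ := fun d => Nat.card {i // F.len i = d}
  let enum : (d : ℕ) → Fin (mult d) ≃ {i // F.len i = d} := fun d => (Finite.equivFin _).symm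
  have hlen : ∀ d (j : Fin (mult d)), F.len (enum d j).1 = d := fun d j => (enum d j).2
  let f : (Σ d : ℕ, Fin (mult d) × Fin d) → Σ i, Fin (F.len i) :=
    fun a => ⟨(enum a.1 a.2.1).1, a.2.2.cast (hlen _ _).symm⟩
  have hinj : ∀ d (j : Fin (mult d)) d' (j' : Fin (mult d')), (enum d j).1 = (enum d' j').1 →
      (⟨d, j⟩ : Σ d : ℕ, Fin (mult d)) = ⟨d', j'⟩ := by
    intro d j d' j' h
    have hd : d = d' := by rw [← hlen d j, h, hlen]
    subst hd
    rw [(enum d).injective (Subtype.ext h)]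
  have hf : Function.Injective f := by
    rintro ⟨d, j, l⟩ ⟨d', j', l'⟩ h
    have h1 := hinj _ _ _ _ (congrArg Sigma.fst h)
    have h2 : (l : ℕ) = l' := congrArg (fun a : Σ i, Fin (F.len i) => (a.2 : ℕ)) h
    obtain ⟨rfl, h3⟩ := Sigma.mk.inj_iff.mp h1
    have h4 : j = j' := eq_of_heq h3
    have h5 : l = l' := Fin.ext h2
    rw [h4, h5]
  have hf' : Function.Surjective f := by
    rintro ⟨i, l⟩
    refine ⟨⟨F.len i, (enum _).symm ⟨i, rfl⟩, l⟩, ?_⟩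
    have h1 : (enum (F.len i) ((enum _).symm ⟨i, rfl⟩)).1 = i := by rw [Equiv.apply_symm_apply]
    refine Sigma.ext h1 ?_
    refine (Fin.heq_ext_iff (congrArg F.len h1)).mpr rfl
  refine ⟨{
    mult := mult
    vec := fun d j => F.vec (enum d j).1
    linearIndependent := ?_
    span_eq := ?_
    pow_eq_zero := ?_
    weight := ?_
    chains_linearIndependent := ?_
    chains_span := ?_
    orthogonal := ?_
    normalized_odd := ?_
    normalized_even := ?_ }⟩
  · intro d
    have := (F.linearIndependent hX).comp
      (fun j : Fin (mult d) => (⟨(enum d j).1, ⟨0, F.len_pos _⟩⟩ : Σ i, Fin (F.len i)))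
      fun j j' h => (enum d).injective (Subtype.ext (congrArg Sigma.fst h))
    simpa [Function.comp_def] using this
  · intro d
    rw [← generators_eq_lowestWeight F hH hY d, ChainBasis.generators]
    congr 2
    ext v
    constructor
    · rintro ⟨j, rfl⟩
      exact ⟨_, hlen d j, rfl⟩
    · rintro ⟨i, hi, rfl⟩
      exact ⟨(enum d).symm ⟨i, hi⟩, by simp⟩
  · intro d j
    rw [← suEnd_pow_apply]
    exact F.pow_eq_zero _ (hlen d j).le
  · intro d j l _
    rw [← suEnd_pow_apply, ← Matrix.toLin'_apply]
    have := F.opH_apply hX (enum d j).1 l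
    rw [hlen, ← hH] at this
    rw [Int.cast_smul_eq_zsmul]
    exact this
  · simp only [← suEnd_pow_apply]
    exact (F.linearIndependent hX).comp f hf
  · simp only [← suEnd_pow_apply]
    refine Eq.trans (congrArg (Submodule.span ℂ) ?_) F.span_eq
    exact hf'.range_comp fun a : Σ i, Fin (F.len i) => (suEnd X ^ (a.2 : ℕ)) (F.vec a.1)
  · intro i k h
    rw [← suEnd_pow_apply, ← suEnd_pow_apply, ← hermSesq_apply]
    refine F.orth _ _ _ _ fun h' => h ⟨hinj _ _ _ _ h'.1, ?_⟩
    rw [h'.2, hlen]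
  · intro d j hd
    have := F.norm (enum d j).1
    rw [hlen, phase, if_pos hd, one_mul, hermSesq_apply, suEnd_pow_apply] at this
    rw [this]
    rcases Int.units_eq_one_or (F.sign (enum d j).1) with h | h <;> simp [h]
  · intro d j hd
    have := F.norm (enum d j).1
    rw [hlen, phase, if_neg (Nat.not_odd_iff_even.mpr hd), hermSesq_apply, suEnd_pow_apply] at this
    rw [this]
    rcases Int.units_eq_one_or (F.sign (enum d j).1) with h | h <;> simp [h]

namespace NormalBasis

variable {X H Y : su p q} (N : NormalBasis X H Y)

lemma pos_of_fin {d : ℕ} (j : Fin (N.mult d)) : 0 < d := by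
  rcases Nat.eq_zero_or_pos d with rfl | h
  · have := N.pow_eq_zero 0 j
    rw [pow_zero, Matrix.one_mulVec] at this
    exact absurd this ((N.linearIndependent 0).ne_zero j)
  · exact h

lemma finite_index : Finite (Σ d, Fin (N.mult d)) := by
  have := N.chains_linearIndependent.finite
  refine Finite.of_injective (fun a : (Σ d, Fin (N.mult d)) =>
    (⟨a.1, a.2, ⟨0, N.pos_of_fin a.2⟩⟩ : Σ d : ℕ, Fin (N.mult d) × Fin d)) ?_
  rintro ⟨d, j⟩ ⟨d', j'⟩ h
  obtain ⟨rfl, h'⟩ := Sigma.mk.inj_iff.mp h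
  have h'' : j = j' := (Prod.mk.inj (eq_of_heq h')).1
  rw [h'']

lemma phase_mul (d : ℕ) (j : Fin (N.mult d)) :
    phase d * hermForm (N.vec d j) ((X : PQMat p q) ^ (d - 1) *ᵥ N.vec d j) = 1 ∨
    phase d * hermForm (N.vec d j) ((X : PQMat p q) ^ (d - 1) *ᵥ N.vec d j) = -1 := by
  rcases Nat.even_or_odd d with h | h
  · rw [phase, if_neg (Nat.not_odd_iff_even.mpr h)]
    exact N.normalized_even d j h
  · rw [phase, if_pos h, one_mul]
    exact N.normalized_odd d j h

open Classical in
/-- The chain basis underlying a normal basis. -/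
noncomputable def toChainBasis :
    ChainBasis (hermSesq p q) (suEnd X) ⊤ (Σ d, Fin (N.mult d)) where
  len i := i.1
  vec i := N.vec i.1 i.2
  sign i := if phase i.1 *
    hermForm (N.vec i.1 i.2) ((X : PQMat p q) ^ (i.1 - 1) *ᵥ N.vec i.1 i.2) = 1 then 1 else -1
  len_pos i := N.pos_of_fin i.2
  pow_len i := by rw [suEnd_pow_apply]; exact N.pow_eq_zero i.1 i.2
  orth i k l m h := by
    have hz : ∀ (i : Σ d, Fin (N.mult d)) l, i.1 ≤ l → (suEnd X ^ l) (N.vec i.1 i.2) = 0 := by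
      intro i l hl
      obtain ⟨n, rfl⟩ := Nat.exists_eq_add_of_le' hl
      rw [← pow_apply_pow, suEnd_pow_apply X i.1, N.pow_eq_zero, map_zero]
    by_cases hl : l < i.1
    · by_cases hm : m < k.1
      · rw [suEnd_pow_apply, suEnd_pow_apply, hermSesq_apply]
        exact N.orthogonal ⟨i.1, i.2, ⟨l, hl⟩⟩ ⟨k.1, k.2, ⟨m, hm⟩⟩ h
      · rw [hz k m (not_lt.mp hm), map_zero]
    · rw [hz i l (not_lt.mp hl), map_zero, LinearMap.zero_apply]
  norm i := by
    rw [suEnd_pow_apply, hermSesq_apply]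
    split_ifs with h
    · rw [h]; simp
    · rw [(N.phase_mul i.1 i.2).resolve_left h]; simp
  span_eq := by
    rw [eq_top_iff, ← N.chains_span]
    refine Submodule.span_le.mpr ?_
    rintro _ ⟨⟨d, j, l⟩, rfl⟩
    exact Submodule.subset_span ⟨⟨⟨d, j⟩, l⟩, suEnd_pow_apply X _ _⟩

lemma card_chains_eq (d : ℕ) (ε : ℤˣ) :
    Nat.card {i // N.toChainBasis.len i = d ∧ N.toChainBasis.sign i = ε} =
      Nat.card {j : Fin (N.mult d) // N.toChainBasis.sign ⟨d, j⟩ = ε} := by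
  refine (Nat.card_eq_of_bijective (fun j : {j : Fin (N.mult d) //
    N.toChainBasis.sign ⟨d, j⟩ = ε} => (⟨⟨d, j.1⟩, rfl, j.2⟩ : {i //
      N.toChainBasis.len i = d ∧ N.toChainBasis.sign i = ε})) ⟨?_, ?_⟩).symm
  · rintro ⟨j, hj⟩ ⟨j', hj'⟩ h
    have := eq_of_heq (Sigma.mk.inj_iff.mp (congrArg Subtype.val h)).2
    exact Subtype.ext this
  · rintro ⟨⟨d', j⟩, rfl, h⟩
    exact ⟨⟨j, h⟩, rfl⟩

lemma plusCount_eq (d : ℕ) : N.plusCount d =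
    Nat.card {i // N.toChainBasis.len i = d ∧ N.toChainBasis.sign i = 1} := by
  rw [card_chains_eq, plusCount]
  refine Nat.card_congr (Equiv.subtypeEquivRight fun j => ?_)
  change phase d * _ = 1 ↔ (if phase d * _ = 1 then (1 : ℤˣ) else -1) = 1
  split_ifs with h
  · simp [h]
  · simp [h]

lemma minusCount_eq (d : ℕ) : N.minusCount d =
    Nat.card {i // N.toChainBasis.len i = d ∧ N.toChainBasis.sign i = -1} := by
  classical
  rw [minusCount, plusCount_eq, card_chains_eq, card_chains_eq]
  have h : ∀ j : Fin (N.mult d), N.toChainBasis.sign ⟨d, j⟩ = -1 ↔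
      ¬ N.toChainBasis.sign ⟨d, j⟩ = 1 := fun j => by
    rcases Int.units_eq_one_or (N.toChainBasis.sign ⟨d, j⟩) with h | h <;> rw [h] <;> decide
  simp only [h, Nat.card_eq_fintype_card, Fintype.card_subtype_compl, Fintype.card_fin]

end NormalBasis
end NormalBases

/-! ### Orbits -/

section Orbits

variable {p q : ℕ}

/-- The endomorphism of `ℂ^{p+q}` defined by an element of `SU(p,q)`. -/
noncomputable abbrev SUEnd (g : SU p q) : Module.End ℂ (PQVec p q) :=
  Matrix.toLin' ((g : Matrix.SpecialLinearGroup (Fin p ⊕ Fin q) ℂ) : PQMat p q)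

lemma hermSesq_SUEnd (g : SU p q) (x y : PQVec p q) :
    hermSesq p q (SUEnd g x) (SUEnd g y) = hermSesq p q x y := by
  have h : ((g : Matrix.SpecialLinearGroup (Fin p ⊕ Fin q) ℂ) : PQMat p q)ᴴ * Ipq p q *
    ((g : Matrix.SpecialLinearGroup (Fin p ⊕ Fin q) ℂ) : PQMat p q) = Ipq p q := g.2
  rw [hermSesq_apply, Matrix.toLin'_apply, Matrix.toLin'_apply, hermForm_mulVec, h]
  rfl

lemma coe_inv_mul_coe (g : SU p q) :
    (((g⁻¹ : SU p q) : Matrix.SpecialLinearGroup (Fin p ⊕ Fin q) ℂ) : PQMat p q) *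
      ((g : Matrix.SpecialLinearGroup (Fin p ⊕ Fin q) ℂ) : PQMat p q) = 1 := by
  rw [← Matrix.SpecialLinearGroup.coe_mul, ← Subgroup.coe_mul, inv_mul_cancel,
    Subgroup.coe_one, Matrix.SpecialLinearGroup.coe_one]

lemma suEnd_Ad_SUEnd (g : SU p q) (X : su p q) (x : PQVec p q) :
    suEnd (Ad g X) (SUEnd g x) = SUEnd g (suEnd X x) := by
  simp only [Matrix.toLin'_apply, Matrix.mulVec_mulVec]
  congr 1
  simp only [Ad, mul_assoc, coe_inv_mul_coe, mul_one]

lemma Ad_one (X : su p q) : Ad 1 X = X := Subtype.ext (by simp [Ad])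

lemma Ad_inv_Ad (g : SU p q) (X : su p q) : Ad g⁻¹ (Ad g X) = X := by
  refine Subtype.ext ?_
  have h := coe_inv_mul_coe g
  simp only [Ad, inv_inv]
  calc _ = ((((g⁻¹ : SU p q) : Matrix.SpecialLinearGroup (Fin p ⊕ Fin q) ℂ) : PQMat p q) *
      ((g : Matrix.SpecialLinearGroup (Fin p ⊕ Fin q) ℂ) : PQMat p q)) * (X : PQMat p q) *
      ((((g⁻¹ : SU p q) : Matrix.SpecialLinearGroup (Fin p ⊕ Fin q) ℂ) : PQMat p q) *
      ((g : Matrix.SpecialLinearGroup (Fin p ⊕ Fin q) ℂ) : PQMat p q)) := by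
        simp only [mul_assoc]
    _ = _ := by rw [h, one_mul, mul_one]

lemma ChainBasis.card_zero {V : Type*} [AddCommGroup V] [Module ℂ V]
    {B : V →ₗ⋆[ℂ] V →ₗ[ℂ] ℂ} {X : Module.End ℂ V} {U : Submodule ℂ V} {ι : Type*}
    (F : ChainBasis B X U ι) (ε : ℤˣ) : Nat.card {i // F.len i = 0 ∧ F.sign i = ε} = 0 := by
  have : IsEmpty {i // F.len i = 0 ∧ F.sign i = ε} := ⟨fun i => (F.len_pos i).ne' i.2.1⟩
  exact Nat.card_of_isEmpty

lemma ChainBasis.card_le_card_Ad {ι ι' : Type*} [Finite ι] [Finite ι'] {X : su p q} (g : SU p q)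
    (F : ChainBasis (hermSesq p q) (suEnd X) ⊤ ι)
    (F' : ChainBasis (hermSesq p q) (suEnd (Ad g X)) ⊤ ι') (d : ℕ) (ε : ℤˣ) :
    Nat.card {i // F.len i = d ∧ F.sign i = ε} ≤ Nat.card {i // F'.len i = d ∧ F'.sign i = ε} := by
  have := Fintype.ofFinite ι
  have := Fintype.ofFinite ι'
  rcases Nat.eq_zero_or_pos d with rfl | hd
  · rw [F.card_zero]; exact Nat.zero_le _
  · have := F.card_le_card (su_skew X) F' (su_skew _) (SUEnd g) (hermSesq_SUEnd g) 1
      (fun x => by rw [suEnd_Ad_SUEnd]; simp) hd ε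
    rwa [one_pow, one_mul] at this

/-- The numbers of chains of given length and sign are the same for all elements of an orbit and
all chain bases. -/
lemma ChainBasis.card_eq_card_Ad {ι ι' : Type*} [Finite ι] [Finite ι'] {X : su p q} (g : SU p q)
    (F : ChainBasis (hermSesq p q) (suEnd X) ⊤ ι)
    (F' : ChainBasis (hermSesq p q) (suEnd (Ad g X)) ⊤ ι') (d : ℕ) (ε : ℤˣ) :
    Nat.card {i // F.len i = d ∧ F.sign i = ε} = Nat.card {i // F'.len i = d ∧ F'.sign i = ε} := by
  refine le_antisymm (F.card_le_card_Ad g F' d ε) ?_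
  have F₂ : ∃ F₂ : ChainBasis (hermSesq p q) (suEnd (Ad g⁻¹ (Ad g X))) ⊤ ι,
      Nat.card {i // F₂.len i = d ∧ F₂.sign i = ε} =
        Nat.card {i // F.len i = d ∧ F.sign i = ε} := by
    rw [Ad_inv_Ad]
    exact ⟨F, rfl⟩
  obtain ⟨F₂, h⟩ := F₂
  rw [← h]
  exact F'.card_le_card_Ad g⁻¹ F₂ d ε

/-- Every diagram of the orbit of `X` counts the chains of any chain basis of `X`. -/
lemma OrbitHasSignedYoungDiagram.counts {X : su p q} {D : SignedYoungDiagram}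
    (hD : OrbitHasSignedYoungDiagram (adjointOrbit X) D) {ι : Type*} [Finite ι]
    (F : ChainBasis (hermSesq p q) (suEnd X) ⊤ ι) (d : ℕ) :
    D.plusCount d = Nat.card {i // F.len i = d ∧ F.sign i = 1} ∧
      D.minusCount d = Nat.card {i // F.len i = d ∧ F.sign i = -1} := by
  obtain ⟨_, ⟨g, rfl⟩, H, Y, -, N, hN⟩ := hD
  have := N.finite_index
  rw [(hN d).1, (hN d).2, N.plusCount_eq, N.minusCount_eq]
  exact ⟨(F.card_eq_card_Ad g N.toChainBasis d 1).symm,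
    (F.card_eq_card_Ad g N.toChainBasis d (-1)).symm⟩

lemma exists_orbitHasSignedYoungDiagram {X : su p q} (hX : X ≠ 0)
    (hnil : IsNilpotent (X : PQMat p q)) :
    ∃ D, OrbitHasSignedYoungDiagram (adjointOrbit X) D := by
  obtain ⟨ι, _, ⟨F⟩⟩ := exists_chainBasis_suEnd X hnil
  obtain ⟨H, Y, hT, ⟨N⟩⟩ := F.exists_normalBasis hX
  have := N.finite_index
  have := Fintype.ofFinite (Σ d, Fin (N.mult d))
  refine ⟨SignedYoungDiagram.ofRows N.toChainBasis.len N.toChainBasis.sign N.toChainBasis.len_pos,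
    X, ⟨1, (Ad_one X).symm⟩, H, Y, hT, N, fun d => ?_⟩
  rw [N.plusCount_eq, N.minusCount_eq]
  exact ⟨SignedYoungDiagram.countP_ofRows _ _ _ d 1, SignedYoungDiagram.countP_ofRows _ _ _ d (-1)⟩

/-- If `-X` lies in the orbit of `X`, then the signs of the chains of even length are balanced,
because replacing `X` by `-X` reverses them. -/
lemma ChainBasis.card_eq_of_isAdReal {X : su p q} (hX : IsAdReal X) {ι : Type*} [Finite ι]
    (F : ChainBasis (hermSesq p q) (suEnd X) ⊤ ι) {d : ℕ} (hd : Even d) :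
    Nat.card {i // F.len i = d ∧ F.sign i = 1} = Nat.card {i // F.len i = d ∧ F.sign i = -1} := by
  have := Fintype.ofFinite ι
  obtain ⟨g, hg⟩ := hX
  rcases Nat.eq_zero_or_pos d with rfl | hd0
  · rw [F.card_zero, F.card_zero]
  have hodd : Odd (d - 1) := by rw [Nat.even_iff] at hd; rw [Nat.odd_iff]; omega
  have h : ∀ x, suEnd X (SUEnd g x) = (((-1 : ℤˣ) : ℤ) : ℂ) • SUEnd g (suEnd X x) := by
    intro x
    rw [← suEnd_Ad_SUEnd, ← hg]
    simp [Matrix.neg_mulVec]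
  have key := F.card_le_card (su_skew X) F (su_skew X) (SUEnd g) (hermSesq_SUEnd g) (-1) h hd0
  simp only [hodd.neg_one_pow, neg_mul, one_mul] at key
  refine le_antisymm (key 1) ?_
  have := key (-1)
  rwa [neg_neg] at this

lemma ChainBasis.isStronglyAdReal {X : su p q} {ι : Type*} [Finite ι]
    (F : ChainBasis (hermSesq p q) (suEnd X) ⊤ ι)
    (h : ∀ d, Even d → Nat.card {i // F.len i = d ∧ F.sign i = 1} =
      Nat.card {i // F.len i = d ∧ F.sign i = -1}) : IsStronglyAdReal X := by
  obtain ⟨τ, hτ2, hdet, hτX, hτB⟩ := F.exists_reversing_involution (su_skew X) h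
  have hT2 : LinearMap.toMatrix' τ * LinearMap.toMatrix' τ = 1 := by
    rw [← LinearMap.toMatrix'_mul, hτ2, LinearMap.toMatrix'_one]
  have hTX : LinearMap.toMatrix' τ * (X : PQMat p q) =
      -((X : PQMat p q) * LinearMap.toMatrix' τ) := by
    have := congrArg LinearMap.toMatrix' hτX
    rwa [map_neg, LinearMap.toMatrix'_mul, LinearMap.toMatrix'_mul,
      LinearMap.toMatrix'_toLin'] at this
  let t : Matrix.SpecialLinearGroup (Fin p ⊕ Fin q) ℂ :=
    ⟨LinearMap.toMatrix' τ, by rw [LinearMap.det_toMatrix', hdet]⟩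
  have ht : t ∈ SU p q := by
    refine matrix_eq_of_dotProduct fun x y => ?_
    rw [← hermForm_mulVec, ← hermSesq_apply]
    change hermSesq p q (LinearMap.toMatrix' τ *ᵥ x) (LinearMap.toMatrix' τ *ᵥ y) = _
    rw [LinearMap.toMatrix'_mulVec, LinearMap.toMatrix'_mulVec, hτB]
    rfl
  have hsq : (⟨t, ht⟩ : SU p q) ^ 2 = 1 := by
    refine Subtype.ext (Subtype.ext ?_)
    rw [sq]
    exact hT2
  refine ⟨⟨t, ht⟩, hsq, Subtype.ext ?_⟩
  have hinv : (⟨t, ht⟩ : SU p q)⁻¹ = ⟨t, ht⟩ := inv_eq_of_mul_eq_one_left (by rw [← sq, hsq])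
  simp only [Ad, hinv]
  change -(X : PQMat p q) = LinearMap.toMatrix' τ * X * LinearMap.toMatrix' τ
  rw [hTX, neg_mul, mul_assoc, hT2, mul_one]

end Orbits

theorem mainTheorem5 (p q : ℕ) (X : su p q) (hX : X ≠ 0)
    (hnil : IsNilpotent (X : PQMat p q)) :
    (∃! D : SignedYoungDiagram, OrbitHasSignedYoungDiagram (adjointOrbit X) D) ∧
    ∀ D : SignedYoungDiagram, OrbitHasSignedYoungDiagram (adjointOrbit X) D →
      List.TFAE [
        IsAdReal X,
        IsStronglyAdReal X,
        ∀ η ∈ D.rows.map List.length, Even η → D.plusCount η = D.minusCount η] := by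
  obtain ⟨ι, _, ⟨F⟩⟩ := exists_chainBasis_suEnd X hnil
  constructor
  · obtain ⟨D, hD⟩ := exists_orbitHasSignedYoungDiagram hX hnil
    refine ⟨D, hD, fun E hE => SignedYoungDiagram.ext_counts (fun d => ?_) fun d => ?_⟩
    · rw [(hD.counts F d).1, (hE.counts F d).1]
    · rw [(hD.counts F d).2, (hE.counts F d).2]
  · intro D hD
    tfae_have 2 → 1 := fun ⟨τ, _, h⟩ => ⟨τ, h⟩
    tfae_have 1 → 3 := by
      intro h η _ hη
      rw [(hD.counts F η).1, (hD.counts F η).2]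
      exact F.card_eq_of_isAdReal h hη
    tfae_have 3 → 2 := by
      intro h
      refine F.isStronglyAdReal fun d hd => ?_
      rw [← (hD.counts F d).1, ← (hD.counts F d).2]
      by_cases hmem : d ∈ D.rows.map List.length
      · exact h d hmem hd
      · -- both counts vanish when no row has length `d`
        have h0 : ∀ r ∈ D.rows, r.length ≠ d := fun r hr h' =>
          hmem (Multiset.mem_map.mpr ⟨r, hr, h'⟩)
        rw [SignedYoungDiagram.plusCount, SignedYoungDiagram.minusCount,
          Multiset.countP_eq_zero.mpr fun r hr h' => h0 r hr h'.1,
          Multiset.countP_eq_zero.mpr fun r hr h' => h0 r hr h'.1]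
    tfae_finish
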